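/- Let $k \ge 0$ be an integer and $\lambda$ a partition. Let $\mathrm{SSYT}_k(\lambda)$ be the set of semistandard Young tableaux of shape $\lambda$ (English notation, rows weakly and columns strictly increasing) with entries in $\{1,\dots,k\}$. The promotion $\mathcal{P}(T)$ of $T \in \mathrm{SSYT}_k(\lambda)$ is obtained as follows: delete all boxes of $T$ that contain a $1$, rectify the resulting skew tableau by jeu de taquin slides (the hole exchanges places with the smaller of the entries directly below it and directly to its right, with the lower one in case of a tie), decrease all entries by $1$, and fill the boxes of $\lambda$ that have become empty with $k$. (If $T$ has no $1$, all entries are just decreased by $1$.) For $1 \le i \le k$ let $\mathcal{P}_i(T)$ be the result of freezing all entries of $T$ that are at least $i+1$ and promoting the tableau formed by the remaining entries with $i$ in place of $k$. The evacuation of $T$ is $\mathcal{E}(T) = \mathcal{P}_1 \circ \mathcal{P}_2 \circ \cdots \circ \mathcal{P}_k(T)$, where $\mathcal{P}_k = \mathcal{P}$. Then $\mathcal{P}$ and $\mathcal{E}$ are maps from $\mathrm{SSYT}_k(\lambda)$ to itself, $\mathcal{P}$ is bijective, and for every $T \in \mathrm{SSYT}_k(\lambda)$: (a) $\mathcal{E}^2(T)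 = T$; (b) $\mathcal{E} \circ \mathcal{P}(T) = \mathcal{P}^{-1} \circ \mathcal{E}(T)$; (c) if $\lambda$ is a rectangle, then $\mathcal{P}^k(T) = T$; (d) if $\lambda$ is a rectangle, then $\mathcal{E}(T) = T^+$, where $T^+$ is obtained from $T$ by rotating it by $180^\circ$ and then replacing each entry $i$ by $k+1-i$. -/

import Mathlib

namespace SSYTPromotion

/-- The set `SSYT_k(lam)` of semistandard Young tableaux of shape `lam` with entries in `{1, …, k}`,
each represented by its function of entries, which vanishes outside `lam`. The box `(i, j)` lies in
row `i` and column `j`, counted from `0`, in English notation. -/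
def SSYT (k : ℕ) (lam : YoungDiagram) : Set (ℕ → ℕ → ℕ) :=
  {f | ∃ T : SemistandardYoungTableau lam, ⇑T = f ∧
    ∀ i j : ℕ, (i, j) ∈ lam → 1 ≤ T i j ∧ T i j ≤ k}

/-- A filling of the boxes of the skew shape `outer / inner`; the values of `entry` at other boxes
are irrelevant. -/
structure SkewFilling where
  outer : Finset (ℕ × ℕ)
  inner : Finset (ℕ × ℕ)
  entry : ℕ → ℕ → ℕ

/-- The box that follows `b` in a jeu de taquin slide: whichever of the boxes of `outer` directly
below `b` and directly to the right of `b` has the smaller entry, the one below in case of a tie;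
`none` if neither of the two lies in `outer`. -/
def nextBox (outer : Finset (ℕ × ℕ)) (f : ℕ → ℕ → ℕ) (b : ℕ × ℕ) : Option (ℕ × ℕ) :=
  if (b.1 + 1, b.2) ∈ outer then
    if (b.1, b.2 + 1) ∈ outer then
      if f (b.1 + 1) b.2 ≤ f b.1 (b.2 + 1) then some (b.1 + 1, b.2) else some (b.1, b.2 + 1)
    else some (b.1 + 1, b.2)
  else if (b.1, b.2 + 1) ∈ outer then some (b.1, b.2 + 1) else none

theorem nextBox_spec {outer : Finset (ℕ × ℕ)} {f : ℕ → ℕ → ℕ} {b c : ℕ × ℕ}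
    (h : nextBox outer f b = some c) : c ∈ outer ∧ b.1 + b.2 < c.1 + c.2 := by
  unfold nextBox at h
  split_ifs at h <;> cases h <;> exact ⟨by assumption, by simp only; omega⟩

/-- The sequence of boxes `b₀, b₁, …, bₘ` of the jeu de taquin slide that starts at `b₀ = b`. -/
def slidePath (outer : Finset (ℕ × ℕ)) (f : ℕ → ℕ → ℕ) (b : ℕ × ℕ) : List (ℕ × ℕ) :=
  match h : nextBox outer f b with
  | none => [b]
  | some c => b :: slidePath outer f c
termination_by (outer.filter (fun x => b.1 + b.2 < x.1 + x.2)).card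
decreasing_by
  obtain ⟨hc, hbc⟩ := nextBox_spec h
  refine Finset.card_lt_card (Finset.ssubset_iff_of_subset ?_ |>.2 ⟨c, ?_, ?_⟩)
  · intro x hx
    rw [Finset.mem_filter] at hx ⊢
    exact ⟨hx.1, hbc.trans hx.2⟩
  · exact Finset.mem_filter.2 ⟨hc, hbc⟩
  · simp

/-- The jeu de taquin slide of `S` at the inner corner `b`: along the path `b₀ = b, b₁, …, bₘ` the
entry of `bᵢ₊₁` moves into `bᵢ`; the last box `bₘ` leaves the outer shape and `b` leaves the inner
shape. -/
def slide (S : SkewFilling) (b : ℕ × ℕ) : SkewFilling where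
  outer := S.outer.filter fun c =>
    ¬ (c ∈ slidePath S.outer S.entry b ∧ nextBox S.outer S.entry c = none)
  inner := S.inner.erase b
  entry i j :=
    if (i, j) ∈ slidePath S.outer S.entry b then
      match nextBox S.outer S.entry (i, j) with
      | some c => S.entry c.1 c.2
      | none => 0
    else S.entry i j

/-- The rightmost box of the lowest nonempty row of a nonempty finite set of boxes. For a Young
diagram, this is one of its corners. -/
def lastBox (s : Finset (ℕ × ℕ)) (h : s.Nonempty) : ℕ × ℕ :=
  ofLex ((s.map toLex.toEmbedding).max' (h.map))

theorem lastBox_mem (s : Finset (ℕ × ℕ)) (h : s.Nonempty) : lastBox s h ∈ s := by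
  have h1 := Finset.max'_mem (s.map toLex.toEmbedding) h.map
  obtain ⟨x, hx, hx'⟩ := Finset.mem_map.1 h1
  have h2 : lastBox s h = x := by
    unfold lastBox
    rw [← hx']
    rfl
  exact h2 ▸ hx

/-- Rectification: slides at inner corners are performed until no inner corner is left. The result
does not depend on the order of the slides, and we always use the inner corner in the lowest
row. (For promotion the inner shape is contained in the first row, so that at each step there
is only one inner corner.) -/
def rectify (S : SkewFilling) : SkewFilling :=
  if h : S.inner.Nonempty then rectify (slide S (lastBox S.inner h)) else S
termination_by S.inner.card
decreasing_by exact Finset.card_erase_lt_of_mem (lastBox_mem S.inner h)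

/-- Promotion with ceiling `k` of a tableau `f` whose set of boxes is `sh`: the boxes that contain a
`1` are deleted, the resulting skew tableau is rectified, all entries are decremented by `1`, and
the boxes of `sh` that have become empty are filled with `k`. (If there are no `1`s,
nothing moves and all entries are decremented.) -/
def promotion (k : ℕ) (sh : Finset (ℕ × ℕ)) (f : ℕ → ℕ → ℕ) : ℕ → ℕ → ℕ := fun i j =>
  let R := rectify ⟨sh, sh.filter (fun c => f c.1 c.2 = 1), f⟩
  if (i, j) ∈ R.outer then R.entry i j - 1
  else if (i, j) ∈ sh then k
  else 0

/-- The entries of `f` that are at least `i + 1` are frozen, and the tableau formed by the remaining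
ones is promoted with ceiling `i`. -/
def promotionUpTo (i : ℕ) (sh : Finset (ℕ × ℕ)) (f : ℕ → ℕ → ℕ) : ℕ → ℕ → ℕ := fun a b =>
  let unfrozen := sh.filter (fun c => f c.1 c.2 ≤ i)
  if (a, b) ∈ unfrozen then promotion i unfrozen f a b else f a b

/-- The sequence `ε₁, ε₂, …`: `ε₁` is the promotion of `f`, and for `j ≥ 2` one obtains `εⱼ` from
`εⱼ₋₁` by freezing the entries `k, …, k - (j - 2)` and promoting the rest, so with ceiling
`k - (j - 1)`. The value at `0` is a convention. -/
def evacuationStep (k : ℕ) (sh : Finset (ℕ × ℕ)) (f : ℕ → ℕ → ℕ) : ℕ → ℕ → ℕ → ℕ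
  | 0 => f
  | 1 => promotion k sh f
  | j + 2 => promotionUpTo (k - (j + 1)) sh (evacuationStep k sh f (j + 1))

/-- Evacuation with ceiling `k`. -/
def evacuation (k : ℕ) (sh : Finset (ℕ × ℕ)) (f : ℕ → ℕ → ℕ) : ℕ → ℕ → ℕ :=
  evacuationStep k sh f k

/-- The rectangle with `m` rows and `n` columns. -/
def rectangle (m n : ℕ) : YoungDiagram where
  cells := Finset.range m ×ˢ Finset.range n
  isLowerSet := by
    intro a b hab ha
    simp only [Finset.coe_product, Finset.coe_range, Set.mem_prod, Set.mem_Iio] at ha ⊢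
    exact ⟨lt_of_le_of_lt hab.1 ha.1, lt_of_le_of_lt hab.2 ha.2⟩

/-- Rotation by 180° of a filling of the `m × n` rectangle, with each entry `e` replaced by
`k + 1 - e`. -/
def rotateComplement (k m n : ℕ) (f : ℕ → ℕ → ℕ) : ℕ → ℕ → ℕ := fun i j =>
  if i < m ∧ j < n then k + 1 - f (m - 1 - i) (n - 1 - j) else 0

end SSYTPromotion

/-! A tableau is the same as its chain of shapes `A 0 ⊆ A 1 ⊆ …`, in which successive shapes differ
by horizontal strips. On chains, promotion P is a sweep of Bender–Knuth toggles: the new shape `t +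
1` is the reflection of `A (t + 1)` between the new shape `t` and `A (t + 2)`. The iterates of P
therefore form a growth diagram whose unit squares all obey one local rule. Evacuation E reads this
diagram in the other direction: its shape `t` is the shape `t` of the (k - t)-th iterate. A toggle
is an involution, so the local rule is symmetric under transposition, and E transposes the diagram
(`IsChain.iterate_evacuation`). This gives E² = 1 and P E P = E, hence also the bijectivity of P and
(b).

For rectangles the key is `IsGrowth.rectangle`: a skew tableau whose outer shape is a rectangle
rectifies to the rotated complement of its inner shape. Crystal raising operators commute with the
local rule (`IsRaiseRow.toggle`) and change neither the inner nor the rectified shape, so the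
tableau may be assumed Yamanouchi, and then both shapes are read off from its content. Applied to
the entries of T above k - t, this yields (d); used twice, it yields (c).

It remains to see that jeu de taquin acts on chains in this way. One slide removes from every shape
the corner occupied by the hole at that moment (`slidLE_hole`), and the new chain satisfies the same
toggle recursion over `A` (`IsSlid.slideChain`). Once all the boxes of the 1s are used up, that
recursion starts from the empty shape and is promotion. -/

namespace SSYTPromotion

/-! ### Toggles, chains of shapes, and the symmetry of the growth diagram -/

/-- `β / α` is a horizontal strip, where `α` and `β` are given by their row lengths. -/
def HStrip (α β : ℕ → ℤ) : Prop := ∀ r, α r ≤ β r ∧ β (r + 1) ≤ α r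

/-- The Bender–Knuth toggle of `β` between `α` and `δ`. -/
def toggle (α β δ : ℕ → ℤ) : ℕ → ℤ
  | 0 => δ 0 + max (α 0) (δ 1) - β 0
  | r + 1 => min (α r) (δ (r + 1)) + max (α (r + 1)) (δ (r + 2)) - β (r + 1)

/-- The strip conditions confine `β r` to the interval from `max (α r) (δ (r + 1))` to `min (α (r -
1)) (δ r)`, with upper end `δ 0` if `r = 0`. The toggle reflects `β r` in this interval. -/
theorem HStrip.toggle_left {α β δ : ℕ → ℤ} (h₁ : HStrip α β) (h₂ : HStrip β δ) :
    HStrip α (toggle α β δ) := by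
  intro r
  have a0 := h₁ r
  have a1 := h₁ (r + 1)
  have b0 := h₂ r
  have b1 := h₂ (r + 1)
  rcases r with _ | r
  · simp only [toggle]
    simp only [zero_add, Nat.reduceAdd] at *
    omega
  · have a2 := h₁ r
    have b2 := h₂ r
    simp only [toggle]
    simp only [add_assoc, Nat.reduceAdd] at *
    omega

theorem HStrip.toggle_right {α β δ : ℕ → ℤ} (h₁ : HStrip α β) (h₂ : HStrip β δ) :
    HStrip (toggle α β δ) δ := by
  intro r
  have a0 := h₁ r
  have a1 := h₁ (r + 1)
  have b0 := h₂ r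
  have b1 := h₂ (r + 1)
  rcases r with _ | r
  · simp only [toggle]
    simp only [zero_add, Nat.reduceAdd] at *
    omega
  · have a2 := h₁ r
    have b2 := h₂ r
    simp only [toggle]
    simp only [add_assoc, Nat.reduceAdd] at *
    omega

theorem toggle_toggle (α β δ : ℕ → ℤ) : toggle α (toggle α β δ) δ = β := by
  funext r
  rcases r with _ | r <;> simp only [toggle] <;> omega

/-- Each row of `β` sits at the lower end of its interval, and the upper end is that of `δ`. -/
theorem HStrip.toggle_self {β δ : ℕ → ℤ} (h : HStrip β δ) : toggle β β δ = δ := by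
  funext r
  have b0 := h r
  rcases r with _ | r
  · simp only [toggle]
    simp only [zero_add] at *
    omega
  · have b2 := h r
    simp only [toggle]
    simp only [add_assoc, Nat.reduceAdd] at *
    omega

/-- The chain of shapes of a semistandard tableau with entries in `{1, …, k}`: `A t r` is the number
of entries at most `t` in row `r`. -/
structure IsChain (k : ℕ) (A : ℕ → ℕ → ℤ) : Prop where
  zero : A 0 = 0
  strip : ∀ t, HStrip (A t) (A (t + 1))
  const : ∀ t, k ≤ t → A t = A k

/-- Promotion of chains with ceiling `k`. -/
def chainPromotion (k : ℕ) (A : ℕ → ℕ → ℤ) : ℕ → ℕ → ℤ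
  | 0 => 0
  | t + 1 => if t + 1 < k then toggle (chainPromotion k A t) (A (t + 1)) (A (t + 2)) else A k

/-- Evacuation of chains. -/
def chainEvacuation (k : ℕ) (A : ℕ → ℕ → ℤ) : ℕ → ℕ → ℤ :=
  fun t => (chainPromotion k)^[k - t] A t

variable {k : ℕ} {A : ℕ → ℕ → ℤ}

theorem IsChain.mono (hA : IsChain k A) (r : ℕ) : Monotone fun t => A t r :=
  monotone_nat_of_le_succ fun t => (hA.strip t r).1

theorem IsChain.nonneg (hA : IsChain k A) (t r : ℕ) : 0 ≤ A t r := by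
  have := hA.mono r (Nat.zero_le t)
  simpa [hA.zero] using this

theorem IsChain.antitone (hA : IsChain k A) (t : ℕ) : Antitone (A t) :=
  antitone_nat_of_succ_le fun r => ((hA.strip t (r + 1)).1).trans (hA.strip t r).2

theorem IsChain.hstrip_self (hA : IsChain k A) (t : ℕ) : HStrip (A t) (A t) :=
  fun r => ⟨le_rfl, hA.antitone t (Nat.le_succ r)⟩

theorem chainPromotion_succ {t : ℕ} (h : t + 1 < k) : chainPromotion k A (t + 1) =
    toggle (chainPromotion k A t) (A (t + 1)) (A (t + 2)) := by
  rw [chainPromotion, if_pos h]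

theorem IsChain.chainPromotion_of_le (hA : IsChain k A) {t : ℕ} (h : k ≤ t) :
    chainPromotion k A t = A k := by
  rcases t with _ | t
  · obtain rfl : k = 0 := by omega
    rw [chainPromotion, hA.zero]
  · rw [chainPromotion, if_neg (by omega)]

theorem IsChain.toggle_chainPromotion {t : ℕ} (h : t + 1 < k) :
    toggle (chainPromotion k A t) (chainPromotion k A (t + 1)) (A (t + 2)) = A (t + 1) := by
  rw [chainPromotion_succ h, toggle_toggle]

/-- These strips are the vertical edges of the growth diagram; they make evacuation a chain. -/
theorem IsChain.hstrip_chainPromotion (hA : IsChain k A) :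
    ∀ t, t < k → HStrip (chainPromotion k A t) (A (t + 1))
  | 0, _ => by
    have := hA.strip 0
    rwa [hA.zero] at this
  | t + 1, h => by
    rw [chainPromotion_succ h]
    exact (hA.hstrip_chainPromotion t (by omega)).toggle_right (hA.strip _)

theorem IsChain.chainPromotion (hA : IsChain k A) : IsChain k (chainPromotion k A) where
  zero := by rw [SSYTPromotion.chainPromotion]
  strip t := by
    rcases lt_trichotomy (t + 1) k with h | h | h
    · rw [chainPromotion_succ h]
      exact (hA.hstrip_chainPromotion t (by omega)).toggle_left (hA.strip _)
    · rw [hA.chainPromotion_of_le h.ge, ← hA.const _ h.ge]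
      exact hA.hstrip_chainPromotion t (by omega)
    · rw [hA.chainPromotion_of_le h.le, hA.chainPromotion_of_le (by omega)]
      exact hA.hstrip_self k
  const t h := by rw [hA.chainPromotion_of_le h, hA.chainPromotion_of_le le_rfl]

theorem IsChain.iterate (hA : IsChain k A) (i : ℕ) :
    IsChain k ((SSYTPromotion.chainPromotion k)^[i] A) := by
  induction i with
  | zero => exact hA
  | succ i ih =>
    rw [Function.iterate_succ_apply']
    exact ih.chainPromotion

theorem IsChain.iterate_apply_top (hA : IsChain k A) (i : ℕ) :
    (SSYTPromotion.chainPromotion k)^[i] A k = A k := by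
  induction i with
  | zero => rfl
  | succ i ih =>
    rw [Function.iterate_succ_apply', (hA.iterate i).chainPromotion_of_le le_rfl, ih]

theorem chainEvacuation_apply {t i : ℕ} (h : i + t = k) :
    chainEvacuation k A t = (chainPromotion k)^[i] A t := by
  rw [chainEvacuation, ← h, Nat.add_sub_cancel]

theorem chainEvacuation_of_le {t : ℕ} (h : k ≤ t) : chainEvacuation k A t = A t := by
  rw [chainEvacuation, Nat.sub_eq_zero_of_le h, Function.iterate_zero_apply]

theorem IsChain.chainEvacuation (hA : IsChain k A) : IsChain k (chainEvacuation k A) where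
  zero := by rw [SSYTPromotion.chainEvacuation, (hA.iterate _).zero]
  strip t := by
    rcases Nat.lt_or_ge t k with h | h
    · rw [chainEvacuation_apply (t := t) (i := k - (t + 1) + 1) (by omega),
        chainEvacuation_apply (t := t + 1) (i := k - (t + 1)) (by omega),
        Function.iterate_succ_apply']
      exact (hA.iterate _).hstrip_chainPromotion t h
    · rw [chainEvacuation_of_le h, chainEvacuation_of_le (by omega)]
      exact hA.strip t
  const t h := by
    rw [chainEvacuation_of_le h, chainEvacuation_of_le le_rfl, hA.const t h]

/-- The four shapes involved at each `t` bound one square of the growth diagram of `A`. The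
recursion for the outer promotion is the growth rule of that square, solved for the opposite corner.
-/
theorem IsChain.chainPromotion_evacuation_promotion (hA : IsChain k A) :
    SSYTPromotion.chainPromotion k
      (SSYTPromotion.chainEvacuation k (SSYTPromotion.chainPromotion k A)) =
      SSYTPromotion.chainEvacuation k A := by
  funext t
  induction t with
  | zero => rw [SSYTPromotion.chainPromotion, hA.chainEvacuation.zero]
  | succ t ih =>
    rcases Nat.lt_or_ge (t + 1) k with h | h
    · obtain ⟨i, rfl⟩ : ∃ i, k = i + (t + 2) := ⟨k - (t + 2), by omega⟩
      rw [chainPromotion_succ h, ih, chainEvacuation_apply (t := t) (i := i + 1 + 1) (by omega),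
        chainEvacuation_apply (t := t + 1) (i := i + 1) (by omega),
        chainEvacuation_apply (t := t + 2) (i := i) (by omega),
        chainEvacuation_apply (t := t + 1) (i := i + 1) (by omega),
        ← Function.iterate_succ_apply, ← Function.iterate_succ_apply,
        Function.iterate_succ_apply' _ (i + 1)]
      exact IsChain.toggle_chainPromotion h
    · rw [hA.chainPromotion.chainEvacuation.chainPromotion_of_le h, chainEvacuation_of_le le_rfl,
        chainEvacuation_of_le h, hA.chainPromotion_of_le le_rfl, hA.const _ h]

/-- The growth diagram of the evacuation is that of `A` transposed. In the double induction three
corners of a square are known to agree, so the fourth does. -/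
theorem IsChain.iterate_evacuation (hA : IsChain k A) (s t u : ℕ) (h : u + s + t = k) :
    (SSYTPromotion.chainPromotion k)^[s] (SSYTPromotion.chainEvacuation k A) t =
      (SSYTPromotion.chainPromotion k)^[u] A t := by
  induction s generalizing t u with
  | zero => exact chainEvacuation_apply h
  | succ s ih =>
    induction t generalizing u with
    | zero => rw [(hA.chainEvacuation.iterate _).zero, (hA.iterate _).zero]
    | succ t iht =>
      have h' : t + 1 < k := by omega
      have e := iht (u + 1) (by omega)
      rw [Function.iterate_succ_apply'] at e ⊢
      rw [chainPromotion_succ h', e, ih (t + 1) (u + 1) (by omega), ih (t + 2) u (by omega),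
        Function.iterate_succ_apply']
      exact IsChain.toggle_chainPromotion h'

theorem IsChain.evacuation_evacuation (hA : IsChain k A) :
    SSYTPromotion.chainEvacuation k (SSYTPromotion.chainEvacuation k A) = A := by
  funext t
  rcases Nat.le_total t k with h | h
  · rw [chainEvacuation_apply (i := k - t) (by omega),
      hA.iterate_evacuation (k - t) t 0 (by omega), Function.iterate_zero_apply]
  · rw [chainEvacuation_of_le h, chainEvacuation_of_le h]

end SSYTPromotion

/-! ### Crystal raising operators on two adjacent letters -/

namespace SSYTPromotion

open Finset

/-- Think of `δ / β` as a letter before sliding and of `toggle α β δ / α` as the same letter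
afterwards. The last term counts the boxes that move up from row `r + 1` to row `r`; the sum
telescopes by `min a d + max 0 (d - a) = d`. -/
theorem sum_toggle_sub (α β δ : ℕ → ℤ) (r : ℕ) :
    ∑ s ∈ range (r + 1), (toggle α β δ s - α s) =
      ∑ s ∈ range (r + 1), (δ s - β s) + max 0 (δ (r + 1) - α r) := by
  induction r with
  | zero =>
    simp only [zero_add, sum_range_one, toggle]
    omega
  | succ r ih =>
    rw [sum_range_succ, ih, sum_range_succ _ (r + 1), toggle]
    simp only [add_assoc, Nat.reduceAdd]
    omega

/-- In the tableau with two letters given by the chain `lam ⊆ μ ⊆ ν`, the number of entries of the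
second letter in the rows up to `r` minus the number of entries of the first letter in the rows
before `r`. -/
def excess (lam μ ν : ℕ → ℤ) (r : ℕ) : ℤ :=
  ∑ s ∈ range (r + 1), (ν s - μ s) - ∑ s ∈ range r, (μ s - lam s)

theorem excess_zero (lam μ ν : ℕ → ℤ) : excess lam μ ν 0 = ν 0 - μ 0 := by
  simp [excess]

theorem excess_succ (lam μ ν : ℕ → ℤ) (r : ℕ) : excess lam μ ν (r + 1) =
    excess lam μ ν r + (ν (r + 1) - μ (r + 1)) - (μ r - lam r) := by
  simp only [excess, sum_range_succ]
  ring

/-- `r` is the row in which the crystal raising operator changes the tableau with two letters given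
by the chain `lam ⊆ μ ⊆ ν`. -/
structure IsRaiseRow (lam μ ν : ℕ → ℤ) (r : ℕ) : Prop where
  pos : 0 < excess lam μ ν r
  le : ∀ s, excess lam μ ν s ≤ excess lam μ ν r
  lt : ∀ s < r, excess lam μ ν s < excess lam μ ν r

/-- The result of adding a box to row `r`. -/
def addBox (μ : ℕ → ℤ) (r : ℕ) : ℕ → ℤ := fun s => if s = r then μ s + 1 else μ s

/-- Reading rows from the top, each from right to left, the excess is the surplus of second letters
just after those of row `r`. A first maximum at `r > 0` means that row `r` has more second letters
than row `r - 1` has first letters, which leaves room to turn one into a first letter. -/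
theorem IsRaiseRow.hstrip {lam μ ν : ℕ → ℤ} {r : ℕ} (h : IsRaiseRow lam μ ν r)
    (h₁ : HStrip lam μ) (h₂ : HStrip μ ν) :
    HStrip lam (addBox μ r) ∧ HStrip (addBox μ r) ν := by
  have key : μ r < ν r ∧ ∀ q, r = q + 1 → μ r < lam q := by
    rcases r with _ | r
    · have := h.pos
      rw [excess_zero] at this
      exact ⟨by omega, by omega⟩
    · have := h.lt r (by omega)
      rw [excess_succ] at this
      have a := h₁ r
      have b := h₂ r
      refine ⟨by omega, fun q hq => ?_⟩
      obtain rfl : r = q := by omega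
      omega
  constructor <;> intro s <;> have a := h₁ s <;> have b := h₂ s
  · have c := key.2 s
    simp only [addBox]
    split_ifs with h1 h2 h2 <;> first | omega | (subst h2; have := c rfl; omega)
  · have c := key.1
    simp only [addBox]
    split_ifs with h1
    · subst h1; omega
    · omega

theorem excess_toggle_zero (lam' lam μ ν : ℕ → ℤ) :
    excess lam' (toggle lam' lam μ) (toggle (toggle lam' lam μ) μ ν) 0 =
      excess lam μ ν 0 + max 0 (ν 1 - toggle lam' lam μ 0) := by
  have := sum_toggle_sub (toggle lam' lam μ) μ ν 0
  simp only [zero_add, sum_range_one] at this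
  rw [excess_zero, excess_zero, this]

theorem excess_toggle_succ (lam' lam μ ν : ℕ → ℤ) (r : ℕ) :
    excess lam' (toggle lam' lam μ) (toggle (toggle lam' lam μ) μ ν) (r + 1) =
      excess lam μ ν (r + 1) + max 0 (ν (r + 2) - toggle lam' lam μ (r + 1)) -
        max 0 (μ (r + 1) - lam' r) := by
  rw [excess, excess, sum_toggle_sub, sum_toggle_sub]
  ring_nf

theorem excess_toggle_zero' (lam' lam μ ν : ℕ → ℤ) :
    excess lam' (toggle lam' lam μ) (toggle (toggle lam' lam μ) μ ν) 0 =
      max (excess lam μ ν 0) (excess lam μ ν 1 - max 0 (lam' 0 - μ 1)) := by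
  rw [excess_toggle_zero, ← zero_add 1, excess_succ, toggle]
  simp only [zero_add]
  omega

/-- In this form each new excess is the larger of two adjacent old ones, each less a nonnegative
penalty, so sliding cannot increase the maximum. -/
theorem excess_toggle_succ' (lam' lam μ ν : ℕ → ℤ) (r : ℕ) :
    excess lam' (toggle lam' lam μ) (toggle (toggle lam' lam μ) μ ν) (r + 1) =
      max (excess lam μ ν (r + 1) - max 0 (μ (r + 1) - lam' r))
        (excess lam μ ν (r + 2) - max 0 (lam' (r + 1) - μ (r + 2))) := by
  rw [excess_toggle_succ, excess_succ _ _ _ (r + 1), toggle]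
  simp only [add_assoc, Nat.reduceAdd]
  omega

theorem excess_toggle_le {lam' lam μ ν : ℕ → ℤ} {M : ℤ} {r : ℕ} (h₁ : excess lam μ ν r ≤ M)
    (h₂ : excess lam μ ν (r + 1) ≤ M) :
    excess lam' (toggle lam' lam μ) (toggle (toggle lam' lam μ) μ ν) r ≤ M := by
  rcases r with _ | r
  · rw [excess_toggle_zero']
    simp only [zero_add] at *
    omega
  · rw [excess_toggle_succ']
    simp only [add_assoc, Nat.reduceAdd] at *
    omega

/-- For `r > 0`, the excess at `r` enters the new rows `r - 1` and `r` with penalties that are the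
positive and negative parts of `lam' (r - 1) - μ r`. One of them vanishes, so the maximum survives
in row `r - 1` or `r`. -/
theorem IsRaiseRow.toggle {lam μ ν : ℕ → ℤ} {r : ℕ} (h : IsRaiseRow lam μ ν r)
    (lam' : ℕ → ℤ) :
    ∃ r', IsRaiseRow lam' (toggle lam' lam μ) (toggle (toggle lam' lam μ) μ ν) r' ∧
      SSYTPromotion.toggle lam' lam (addBox μ r) =
        addBox (SSYTPromotion.toggle lam' lam μ) r' ∧
      SSYTPromotion.toggle (addBox (SSYTPromotion.toggle lam' lam μ) r') (addBox μ r) ν =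
        SSYTPromotion.toggle (SSYTPromotion.toggle lam' lam μ) μ ν := by
  have hle : ∀ s, excess lam' (SSYTPromotion.toggle lam' lam μ)
      (SSYTPromotion.toggle (SSYTPromotion.toggle lam' lam μ) μ ν) s ≤ excess lam μ ν r :=
    fun s => excess_toggle_le (h.le s) (h.le (s + 1))
  have hlt : ∀ s, s + 1 < r → excess lam' (SSYTPromotion.toggle lam' lam μ)
      (SSYTPromotion.toggle (SSYTPromotion.toggle lam' lam μ) μ ν) s < excess lam μ ν r :=
    fun s hs => Int.lt_of_le_sub_one <| excess_toggle_le
      (Int.le_sub_one_of_lt (h.lt s (by omega))) (Int.le_sub_one_of_lt (h.lt (s + 1) hs))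
  have hraise : ∀ r', excess lam' (SSYTPromotion.toggle lam' lam μ)
      (SSYTPromotion.toggle (SSYTPromotion.toggle lam' lam μ) μ ν) r' = excess lam μ ν r →
      (∀ s < r', excess lam' (SSYTPromotion.toggle lam' lam μ)
        (SSYTPromotion.toggle (SSYTPromotion.toggle lam' lam μ) μ ν) s < excess lam μ ν r) →
      IsRaiseRow lam' (SSYTPromotion.toggle lam' lam μ)
        (SSYTPromotion.toggle (SSYTPromotion.toggle lam' lam μ) μ ν) r' := fun r' e l =>
    ⟨e ▸ h.pos, fun s => e ▸ hle s, fun s hs => e ▸ l s hs⟩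
  -- A box added to row `r = q + 1` of `μ` increases the `max` term in row `q` of the toggle exactly
  -- if `lam' q ≤ μ r`, and the `min` term in row `r` otherwise.
  by_cases hc : ∃ q, r = q + 1 ∧ lam' q ≤ μ r
  · obtain ⟨q, rfl, hq⟩ := hc
    have hM : excess lam' (SSYTPromotion.toggle lam' lam μ)
        (SSYTPromotion.toggle (SSYTPromotion.toggle lam' lam μ) μ ν) q =
        excess lam μ ν (q + 1) := by
      refine le_antisymm (hle q) ?_
      rcases q with _ | q
      · rw [excess_toggle_zero']
        simp only [zero_add] at *
        omega
      · rw [excess_toggle_succ']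
        simp only [add_assoc, Nat.reduceAdd] at *
        omega
    -- Hence the new box affects the second toggle only through the `min` term of row `q + 1`, where
    -- the box added to `μ` cancels it.
    have hy : SSYTPromotion.toggle lam' lam μ q < ν (q + 1) := by
      have := h.lt q (by omega)
      rcases q with _ | q
      · rw [excess_toggle_zero] at hM
        simp only [zero_add] at *
        omega
      · rw [excess_toggle_succ] at hM
        simp only [add_assoc, Nat.reduceAdd] at *
        omega
    refine ⟨q, hraise q hM fun s hs => hlt s (by omega), ?_, ?_⟩
    · funext s
      rcases s with _ | s <;>
      simp only [addBox, SSYTPromotion.toggle] <;> grind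
    · generalize SSYTPromotion.toggle lam' lam μ = μ' at *
      funext s
      rcases s with _ | s <;>
      simp only [addBox, SSYTPromotion.toggle] <;> grind
  · have hM : excess lam' (SSYTPromotion.toggle lam' lam μ)
        (SSYTPromotion.toggle (SSYTPromotion.toggle lam' lam μ) μ ν) r =
        excess lam μ ν r := by
      refine le_antisymm (hle r) ?_
      rcases r with _ | r
      · rw [excess_toggle_zero']
        omega
      · have : ¬ lam' r ≤ μ (r + 1) := fun h => hc ⟨r, rfl, h⟩
        rw [excess_toggle_succ']
        omega
    -- Here the new box affects only the `max` term of row `r`, and the box added to `μ` cancels it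
    -- there.
    have hy : ν (r + 1) ≤ SSYTPromotion.toggle lam' lam μ r := by
      rcases r with _ | r
      · rw [excess_toggle_zero] at hM
        simp only [zero_add] at *
        omega
      · have : ¬ lam' r ≤ μ (r + 1) := fun h => hc ⟨r, rfl, h⟩
        rw [excess_toggle_succ] at hM
        simp only [add_assoc, Nat.reduceAdd] at *
        omega
    refine ⟨r, hraise r hM fun s hs => ?_, ?_, ?_⟩
    · rcases Nat.lt_or_ge (s + 1) r with hs' | hs'
      · exact hlt s hs'
      · obtain rfl : r = s + 1 := by omega
        have a : ¬ lam' s ≤ μ (s + 1) := fun h => hc ⟨s, rfl, h⟩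
        have b := h.lt s (by omega)
        rcases s with _ | s
        · rw [excess_toggle_zero']
          simp only [zero_add] at *
          omega
        · rw [excess_toggle_succ']
          simp only [add_assoc, Nat.reduceAdd] at *
          omega
    · funext s
      rcases s with _ | s <;>
      simp only [addBox, SSYTPromotion.toggle] <;> grind
    · generalize SSYTPromotion.toggle lam' lam μ = μ' at *
      funext s
      rcases s with _ | s <;>
      simp only [addBox, SSYTPromotion.toggle] <;> grind

end SSYTPromotion

/-! ### Growth diagrams -/

namespace SSYTPromotion

open Finset

/-- A growth diagram with rows `S 0, …, S j` and columns `0, …, p`: the row `S 0` is the chain of a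
skew tableau, and each row arises from the preceding one by sliding into a horizontal strip. -/
structure IsGrowth (j p : ℕ) (S : ℕ → ℕ → ℕ → ℤ) : Prop where
  horizontal : ∀ i ≤ j, ∀ t < p, HStrip (S i t) (S i (t + 1))
  vertical : ∀ i < j, ∀ t ≤ p, HStrip (S (i + 1) t) (S i t)
  growth : ∀ i < j, ∀ t < p, S (i + 1) (t + 1) = toggle (S (i + 1) t) (S i t) (S i (t + 1))
  zero : S j 0 = 0

variable {j p : ℕ} {S : ℕ → ℕ → ℕ → ℤ}

/-- Raising operators commute with the growth rule. -/
theorem IsGrowth.exists_raise (hS : IsGrowth j p S) {s r₀ : ℕ} (hs : s + 1 < p)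
    (hr : IsRaiseRow (S 0 s) (S 0 (s + 1)) (S 0 (s + 2)) r₀) :
    ∃ S', IsGrowth j p S' ∧ (∀ i t, t ≠ s + 1 → S' i t = S i t) ∧
      S' 0 (s + 1) = addBox (S 0 (s + 1)) r₀ := by
  have step : ∀ i r, ∃ r', i < j → IsRaiseRow (S i s) (S i (s + 1)) (S i (s + 2)) r →
      IsRaiseRow (S (i + 1) s) (S (i + 1) (s + 1)) (S (i + 1) (s + 2)) r' ∧
      toggle (S (i + 1) s) (S i s) (addBox (S i (s + 1)) r) = addBox (S (i + 1) (s + 1)) r' ∧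
      toggle (addBox (S (i + 1) (s + 1)) r') (addBox (S i (s + 1)) r) (S i (s + 2)) =
        S (i + 1) (s + 2) := by
    intro i r
    by_cases h : i < j ∧ IsRaiseRow (S i s) (S i (s + 1)) (S i (s + 2)) r
    · obtain ⟨r', h'⟩ := h.2.toggle (S (i + 1) s)
      rw [← hS.growth i h.1 s (by omega), ← hS.growth i h.1 (s + 1) hs] at h'
      exact ⟨r', fun _ _ => h'⟩
    · exact ⟨0, fun h₁ h₂ => absurd ⟨h₁, h₂⟩ h⟩
  choose F hF using step
  -- `ρ i` is the row in which the raised box lies in row `i` of the diagram.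
  let ρ : ℕ → ℕ := fun i => Nat.rec r₀ F i
  have hρ : ∀ i ≤ j, IsRaiseRow (S i s) (S i (s + 1)) (S i (s + 2)) (ρ i) := by
    intro i
    induction i with
    | zero => exact fun _ => hr
    | succ i ih => exact fun hi => (hF i (ρ i) hi (ih (by omega))).1
  have hst : ∀ i ≤ j, HStrip (S i s) (addBox (S i (s + 1)) (ρ i)) ∧
      HStrip (addBox (S i (s + 1)) (ρ i)) (S i (s + 2)) := fun i hi =>
    (hρ i hi).hstrip (hS.horizontal i hi s (by omega)) (hS.horizontal i hi (s + 1) hs)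
  refine ⟨fun i t => if t = s + 1 then addBox (S i t) (ρ i) else S i t, ?_, ?_, ?_⟩
  · constructor
    · intro i hi t ht
      rcases eq_or_ne t s with rfl | h₁
      · simpa using (hst i hi).1
      rcases eq_or_ne t (s + 1) with rfl | h₂
      · simpa using (hst i hi).2
      · simpa [h₁, h₂] using hS.horizontal i hi t ht
    · intro i hi t ht
      rcases eq_or_ne t (s + 1) with rfl | h₂
      · have e := (hF i (ρ i) hi (hρ i hi.le)).2.1
        simp only [if_true]
        change HStrip (addBox _ (F i (ρ i))) _
        rw [← e]
        exact (hS.vertical i hi s (by omega)).toggle_right (hst i hi.le).1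
      · simpa [h₂] using hS.vertical i hi t ht
    · intro i hi t ht
      have e := (hF i (ρ i) hi (hρ i hi.le)).2
      rcases eq_or_ne t s with rfl | h₁
      · simpa using e.1.symm
      rcases eq_or_ne t (s + 1) with rfl | h₂
      · simpa using e.2.symm
      · simpa [h₁, h₂] using hS.growth i hi t ht
    · simpa using hS.zero
  · intro i t ht
    simp [ht]
  · simp [ρ]

theorem IsGrowth.le_top (hS : IsGrowth j p S) {i t : ℕ} (hi : i ≤ j) (ht : t ≤ p) (r : ℕ) :
    S i t r ≤ S 0 p r := by
  have h₁ : S i t r ≤ S 0 t r := by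
    induction i with
    | zero => exact le_rfl
    | succ i ih => exact ((hS.vertical i hi t ht r).1).trans (ih (by omega))
  exact h₁.trans (Nat.decreasingInduction (motive := fun t _ => S 0 t r ≤ S 0 p r)
    (fun t ht ih => ((hS.horizontal 0 (by omega) t ht r).1).trans ih) le_rfl ht)

theorem IsGrowth.nonneg (hS : IsGrowth j p S) {i t : ℕ} (hi : i ≤ j) (ht : t ≤ p) (r : ℕ) :
    0 ≤ S i t r := by
  have h₁ : 0 ≤ S j t r := by
    induction t with
    | zero => simp [hS.zero]
    | succ t ih => exact (ih (by omega)).trans (hS.horizontal j le_rfl t (by omega) r).1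
  exact Nat.decreasingInduction (motive := fun i _ => 0 ≤ S i t r)
    (fun i hi ih => ih.trans (hS.vertical i hi t ht r).1) h₁ hi

/-! ### Growth diagrams with rectangular outer shape -/

/-- The row lengths of the rectangle with `m` rows and `n` columns. -/
def rectangleRows (m : ℕ) (n : ℤ) : ℕ → ℤ := fun r => if r < m then n else 0

variable {m : ℕ} {n : ℤ}

theorem IsGrowth.eq_zero (hS : IsGrowth j p S) (htop : S 0 p = rectangleRows m n) {i t r : ℕ}
    (hi : i ≤ j) (ht : t ≤ p) (hr : m ≤ r) : S i t r = 0 := by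
  have a := hS.le_top hi ht r
  have b := hS.nonneg hi ht r
  rw [htop, rectangleRows, if_neg (by omega)] at a
  omega

/-- Slides preserve the content: below row `m` there are no boxes that could move up. -/
theorem IsGrowth.content_eq (hS : IsGrowth j p S) (htop : S 0 p = rectangleRows m n) {i t : ℕ}
    (hi : i ≤ j) (ht : t < p) : ∑ q ∈ range m, (S i (t + 1) q - S i t q) =
      ∑ q ∈ range m, (S 0 (t + 1) q - S 0 t q) := by
  induction i with
  | zero => rfl
  | succ i ih =>
    rw [← ih (by omega), hS.growth i hi t ht]
    rcases m with _ | m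
    · simp
    · rw [sum_toggle_sub, hS.eq_zero htop (by omega) ht le_rfl]
      have := hS.nonneg hi ht.le m
      omega

theorem IsGrowth.excess_nonpos (hS : IsGrowth j p S)
    (h : ∀ s, s + 1 < p → ∀ r, excess (S 0 s) (S 0 (s + 1)) (S 0 (s + 2)) r ≤ 0) {i s : ℕ}
    (hi : i ≤ j) (hs : s + 1 < p) (r : ℕ) :
    excess (S i s) (S i (s + 1)) (S i (s + 2)) r ≤ 0 := by
  induction i generalizing r with
  | zero => exact h s hs r
  | succ i ih =>
    rw [hS.growth i hi (s + 1) hs, hS.growth i hi s (by omega)]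
    exact excess_toggle_le (ih (by omega) r) (ih (by omega) (r + 1))

/-- In a Yamanouchi tableau of straight shape, row `r` consists of all letters `r + 1`. -/
theorem straight_yamanouchi {B : ℕ → ℕ → ℤ} (hB : ∀ t < p, HStrip (B t) (B (t + 1)))
    (h0 : B 0 = 0)
    (h : ∀ s, s + 1 < p → ∀ r, excess (B s) (B (s + 1)) (B (s + 2)) r ≤ 0) {r : ℕ} (hr : r < m) :
    B p r = if r < p then ∑ q ∈ range m, (B (r + 1) q - B r q) else 0 := by
  have low : ∀ t ≤ p, ∀ r, t ≤ r → B t r = 0 := by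
    intro t
    induction t with
    | zero => simp [h0]
    | succ t ih =>
      intro ht r hr
      obtain ⟨r, rfl⟩ : ∃ q, r = q + 1 := ⟨r - 1, by omega⟩
      have a := hB t (by omega) r
      have b := hB t (by omega) (r + 1)
      rw [ih (by omega) r (by omega)] at a
      rw [ih (by omega) (r + 1) (by omega)] at b
      omega
  -- By induction the letter `s + 1` is absent above row `s`, so the excess at row `s` just counts
  -- the letters `s + 2` in the rows up to `s`.
  have high : ∀ s < p, ∀ r < s, B (s + 1) r = B s r := by
    intro s
    induction s with
    | zero => omega
    | succ s ih =>
      intro hs r hr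
      have e := h s hs s
      have z : ∑ q ∈ range s, (B (s + 1) q - B s q) = 0 :=
        sum_eq_zero fun q hq => by rw [ih (by omega) q (mem_range.1 hq), sub_self]
      rw [excess, z, sub_zero] at e
      have nn : ∀ q ∈ range (s + 1), 0 ≤ B (s + 2) q - B (s + 1) q := fun q _ =>
        sub_nonneg.2 (hB (s + 1) hs q).1
      have := (sum_eq_zero_iff_of_nonneg nn).1 (le_antisymm e (sum_nonneg nn)) r (by simpa using hr)
      linarith
  split_ifs with hp
  · have final : ∀ d, r + 1 + d ≤ p → B (r + 1 + d) r = B (r + 1) r := by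
      intro d
      induction d with
      | zero => exact fun _ => rfl
      | succ d ih =>
        intro hd
        rw [← ih (by omega)]
        exact high (r + 1 + d) (by omega) r (by omega)
    have hfin := final (p - (r + 1)) (by omega)
    rw [Nat.add_sub_cancel' (by omega : r + 1 ≤ p)] at hfin
    rw [hfin, sum_eq_single_of_mem r (mem_range.2 hr)]
    · rw [low r hp.le r le_rfl, sub_zero]
    · intro q _ hq
      rcases Nat.lt_or_gt_of_ne hq with hq | hq
      · rw [high r hp q hq, sub_self]
      · rw [low (r + 1) hp q hq, low r hp.le q hq.le, sub_self]
  · exact low p le_rfl r (by omega)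

/-- The row lengths `α`, preceded by a row of length `n`. -/
def prependRow (n : ℤ) (α : ℕ → ℤ) : ℕ → ℤ
  | 0 => n
  | q + 1 => α q

/-- In a Yamanouchi tableau whose outer shape is a rectangle, each horizontal strip is as large as
possible. -/
theorem rectangle_yamanouchi {B : ℕ → ℕ → ℤ} (hB : ∀ t < p, HStrip (B t) (B (t + 1)))
    (htop : B p = rectangleRows m n)
    (h : ∀ s, s + 1 < p → ∀ r, excess (B s) (B (s + 1)) (B (s + 2)) r ≤ 0) {r : ℕ} (hr : r < m) :
    ∀ t < p, B (t + 1) r = prependRow n (B t) r := by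
  have top : ∀ r < m, B p r = n := fun r hr => by rw [htop, rectangleRows, if_pos hr]
  have hle : ∀ t ≤ p, ∀ r < m, B t r ≤ n := by
    intro t ht r hr
    rw [← top r hr]
    exact Nat.decreasingInduction (fun t ht ih => ((hB t ht r).1).trans ih) le_rfl ht
  induction r using Nat.strong_induction_on with
  | _ r ih =>
  rcases r with _ | r
  · intro t ht
    refine le_antisymm (hle _ ht 0 hr) ?_
    obtain ⟨d, rfl⟩ : ∃ d, p = t + 1 + d := ⟨p - (t + 1), by omega⟩
    have key : ∀ e ≤ d, B (t + 1 + e) 0 ≤ B (t + 1) 0 := by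
      intro e
      induction e with
      | zero => exact fun _ => le_rfl
      | succ e ih =>
        intro he
        refine le_trans ?_ (ih (by omega))
        have a := h (t + e) (by omega) 0
        rw [excess_zero, (by omega : t + e + 1 = t + 1 + e),
          (by omega : t + e + 2 = t + 1 + (e + 1))] at a
        omega
    rw [← top 0 hr]
    exact key d le_rfl
  · have total : ∀ r' ≤ r, ∀ s < p, ∑ q ∈ range (r' + 1), (B (s + 1) q - B s q) = n - B s r' := by
      intro r'
      induction r' with
      | zero =>
        intro _ s hs
        rw [zero_add, sum_range_one, ih 0 (by omega) (by omega) s hs, prependRow]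
      | succ r' ihr =>
        intro hr' s hs
        rw [sum_range_succ, ihr (by omega) s hs, ih (r' + 1) (by omega) (by omega) s hs,
          prependRow]
        ring
    intro t ht
    refine le_antisymm (hB t ht r).2 ?_
    obtain ⟨d, rfl⟩ : ∃ d, p = t + 1 + d := ⟨p - (t + 1), by omega⟩
    -- The lattice condition at row `r + 1` makes `B (s + 1) (r + 1) - B s r` nonincreasing in `s`.
    -- It is at most 0 by the strip condition, and its last value `n - B (p - 1) r` is at least 0,
    -- so it vanishes throughout.
    have key : ∀ e ≤ d, B (t + 1 + e) (r + 1) - B (t + e) r ≤ B (t + 1) (r + 1) - B t r := by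
      intro e
      induction e with
      | zero => exact fun _ => le_rfl
      | succ e ih =>
        intro he
        refine le_trans ?_ (ih (by omega))
        have a := h (t + e) (by omega) (r + 1)
        rw [excess, sum_range_succ, total r le_rfl (t + e + 1) (by omega),
          total r le_rfl (t + e) (by omega), (by omega : t + e + 1 = t + 1 + e),
          (by omega : t + e + 2 = t + 1 + (e + 1))] at a
        rw [(by omega : t + (e + 1) = t + 1 + e)]
        omega
    have a := key d le_rfl
    rw [top (r + 1) hr] at a
    have b := hle (t + d) (by omega) r (by omega)
    show B t r ≤ _
    omega

/-- Rectification of a skew tableau whose outer shape is a rectangle, and whose inner shape is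
`S 0 0`, yields a tableau of the complementary shape. -/
theorem IsGrowth.rectangle_of_yamanouchi (hS : IsGrowth j p S) (htop : S 0 p = rectangleRows m n)
    (h : ∀ s, s + 1 < p → ∀ r, excess (S 0 s) (S 0 (s + 1)) (S 0 (s + 2)) r ≤ 0) {r : ℕ}
    (hr : r < m) : S j p r = n - S 0 0 (m - 1 - r) := by
  have hB := hS.horizontal 0 (by omega)
  have shift : ∀ q < m, ∀ t < p, S 0 (t + 1) q = prependRow n (S 0 t) q :=
    fun q hq => rectangle_yamanouchi hB htop h hq
  have down : ∀ d t, t + d ≤ p → ∀ q, q + d < m → S 0 (t + d) (q + d) = S 0 t q := by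
    intro d
    induction d with
    | zero => exact fun _ _ _ _ => rfl
    | succ d ih =>
      intro t ht q hq
      rw [← ih t (by omega) q (by omega), ← add_assoc, ← add_assoc]
      exact shift (q + d + 1) hq (t + d) ht
  have anti : Antitone (S 0 0) ∨ p = 0 := by
    rcases p with _ | p
    · exact .inr rfl
    · exact .inl (antitone_nat_of_succ_le fun q =>
        ((hB 0 (by omega) (q + 1)).1).trans (hB 0 (by omega) q).2)
  have total : ∀ t < p, ∀ q < m, ∑ q ∈ range (q + 1), (S 0 (t + 1) q - S 0 t q) = n - S 0 t q := by
    intro t ht q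
    induction q with
    | zero =>
      intro hq
      rw [zero_add, sum_range_one, shift 0 hq t ht, prependRow]
    | succ q ih =>
      intro hq
      rw [sum_range_succ, ih (by omega), shift (q + 1) hq t ht, prependRow]
      ring
  obtain ⟨m, rfl⟩ : ∃ m', m = m' + 1 := ⟨m - 1, by omega⟩
  rw [straight_yamanouchi (hS.horizontal j le_rfl) hS.zero
    (fun s hs => hS.excess_nonpos h le_rfl hs) hr, Nat.add_sub_cancel]
  split_ifs with hp
  · rw [hS.content_eq htop le_rfl hp, total r hp m (by omega)]
    have := down r 0 (by omega) (m - r) (by omega)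
    rw [Nat.sub_add_cancel (by omega), zero_add] at this
    rw [this]
  -- There is no letter `r + 1`, so the inner row in question must have full length: the full row
  -- `m` of the rectangle shifts diagonally back to row `m - p` of the inner shape.
  · have a := down p 0 (by omega) (m - p) (by omega)
    rw [zero_add, htop, rectangleRows, if_pos (by omega)] at a
    have b : S 0 0 (m - p) ≤ S 0 0 (m - r) := by
      rcases anti with h | rfl
      · exact h (by omega)
      · rw [htop, rectangleRows, rectangleRows, if_pos (by omega), if_pos (by omega)]
    have c := hS.le_top (i := 0) (t := 0) (by omega) (by omega) (m - r)
    rw [htop, rectangleRows, if_pos (by omega)] at c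
    omega

/-- From row `m` on the excess cannot increase, so it attains its maximum; the first maximal row is
the one sought. -/
theorem exists_isRaiseRow {lam μ ν : ℕ → ℤ} (h₁ : HStrip lam μ) (hμ : ∀ r, m ≤ r → μ r = 0)
    (hν : ∀ r, m ≤ r → ν r = 0) (h : ∃ r, 0 < excess lam μ ν r) :
    ∃ r, IsRaiseRow lam μ ν r := by
  obtain ⟨q, -, hq⟩ := exists_max_image (range (m + 1)) (excess lam μ ν) ⟨0, by simp⟩
  have tail : ∀ d, excess lam μ ν (m + d) ≤ excess lam μ ν m := by
    intro d
    induction d with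
    | zero => exact le_rfl
    | succ d ih =>
      have a := (h₁ (m + d)).1
      rw [← add_assoc, excess_succ, hμ _ (by omega), hν _ (by omega)]
      rw [hμ _ (by omega)] at a ⊢
      omega
  have hmax : ∃ q, ∀ s, excess lam μ ν s ≤ excess lam μ ν q := by
    refine ⟨q, fun s => ?_⟩
    rcases Nat.le_total s m with hs | hs
    · exact hq s (by simp; omega)
    · obtain ⟨d, rfl⟩ := Nat.exists_eq_add_of_le hs
      exact (tail d).trans (hq m (by simp))
  classical
  refine ⟨Nat.find hmax, ?_, Nat.find_spec hmax, fun s hs => ?_⟩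
  · obtain ⟨r, hr⟩ := h
    exact hr.trans_le (Nat.find_spec hmax r)
  · have := Nat.find_min hmax hs
    push Not at this
    obtain ⟨u, hu⟩ := this
    exact hu.trans_le (Nat.find_spec hmax u)

/-- Raising touches only the column `s + 1`, which lies strictly between `0` and `p`, so both shapes
in the claim are fixed. Each raise enlarges one shape of row `0`, so the process ends, at a
Yamanouchi tableau. -/
theorem IsGrowth.rectangle (hS : IsGrowth j p S) (htop : S 0 p = rectangleRows m n) {r : ℕ}
    (hr : r < m) : S j p r = n - S 0 0 (m - 1 - r) := by
  generalize hN : (∑ t ∈ range p, ∑ q ∈ range m, (n - S 0 t q)).toNat = N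
  induction N using Nat.strong_induction_on generalizing S with
  | _ N ih =>
  by_cases h : ∀ s, s + 1 < p → ∀ r, excess (S 0 s) (S 0 (s + 1)) (S 0 (s + 2)) r ≤ 0
  · exact hS.rectangle_of_yamanouchi htop h hr
  · push Not at h
    obtain ⟨s, hs, hex⟩ := h
    obtain ⟨r₀, hr₀⟩ := exists_isRaiseRow (hS.horizontal 0 (by omega) s (by omega))
      (fun q hq => hS.eq_zero htop (by omega) (by omega) hq)
      (fun q hq => hS.eq_zero htop (by omega) (by omega) hq) hex
    obtain ⟨S', hS', hne, heq⟩ := hS.exists_raise hs hr₀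
    have htop' : S' 0 p = rectangleRows m n := by rw [hne 0 p (by omega), htop]
    have hr₀m : r₀ < m := by
      by_contra hc
      have a := hS'.eq_zero htop' (i := 0) (t := s + 1) (by omega) (by omega) (not_lt.1 hc)
      have b := hS.eq_zero htop (i := 0) (t := s + 1) (by omega) (by omega) (not_lt.1 hc)
      rw [heq, addBox, if_pos rfl] at a
      omega
    have nn : ∀ S' : ℕ → ℕ → ℕ → ℤ, IsGrowth j p S' → S' 0 p = rectangleRows m n →
        0 ≤ ∑ t ∈ range p, ∑ q ∈ range m, (n - S' 0 t q) := by
      intro S' hS' htop'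
      refine sum_nonneg fun t ht => sum_nonneg fun q hq => ?_
      have := hS'.le_top (i := 0) (by omega) (mem_range.1 ht).le q
      rw [htop', rectangleRows, if_pos (mem_range.1 hq)] at this
      omega
    have lt : ∑ t ∈ range p, ∑ q ∈ range m, (n - S' 0 t q) <
        ∑ t ∈ range p, ∑ q ∈ range m, (n - S 0 t q) := by
      have le : ∀ t q, n - S' 0 t q ≤ n - S 0 t q := by
        intro t q
        rcases eq_or_ne t (s + 1) with rfl | ht
        · rw [heq, addBox]
          split_ifs <;> omega
        · rw [hne 0 t ht]
      refine sum_lt_sum (fun t _ => sum_le_sum fun q _ => le t q)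
        ⟨s + 1, mem_range.2 hs, sum_lt_sum (fun q _ => le _ q) ⟨r₀, mem_range.2 hr₀m, ?_⟩⟩
      rw [heq, addBox, if_pos rfl]
      omega
    have := ih _ (by have := nn S hS htop; have := nn S' hS' htop'; omega) hS' htop' rfl
    rwa [hne j p (by omega), hne 0 0 (by omega)] at this

/-! ### Evacuation and promotion of rectangular chains -/

variable {k : ℕ} {A : ℕ → ℕ → ℤ}

/-- Row `0` is the chain from `A j` to `A k`, the skew tableau of the entries above `j`. Each
promotion lowers the letters by one, hence the shift by `i`. -/
theorem IsChain.isGrowth (hA : IsChain k A) {j p : ℕ} (h : j + p = k) :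
    IsGrowth j p fun i t => (SSYTPromotion.chainPromotion k)^[i] A (j + t - i) where
  horizontal i hi t ht := by
    have e : j + (t + 1) - i = j + t - i + 1 := by omega
    simp only [e]
    exact (hA.iterate i).strip _
  vertical i hi t ht := by
    have e : j + t - i = j + t - (i + 1) + 1 := by omega
    simp only [e, Function.iterate_succ_apply']
    exact (hA.iterate i).hstrip_chainPromotion _ (by omega)
  growth i hi t ht := by
    have e : j + t - i = j + t - (i + 1) + 1 := by omega
    have e' : j + (t + 1) - (i + 1) = j + t - (i + 1) + 1 := by omega
    have e'' : j + (t + 1) - i = j + t - (i + 1) + 2 := by omega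
    simp only [e, e', e'', Function.iterate_succ_apply']
    exact chainPromotion_succ (by omega)
  zero := by
    simp only [add_zero, Nat.sub_self]
    exact (hA.iterate j).zero

/-- Evacuation of a rectangular tableau is rotation and complementation. -/
theorem IsChain.evacuation_rectangle (hA : IsChain k A) (htop : A k = rectangleRows m n) {t r : ℕ}
    (ht : t ≤ k) (hr : r < m) :
    SSYTPromotion.chainEvacuation k A t r = n - A (k - t) (m - 1 - r) := by
  have e : k - t + t - 0 = k := by omega
  have := (hA.isGrowth (j := k - t) (p := t) (by omega)).rectangle
    (by simpa only [e, Function.iterate_zero_apply] using htop) hr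
  simp only [add_zero, Nat.sub_zero, Function.iterate_zero_apply, Nat.add_sub_cancel_left] at this
  exact this

/-- The complement formula is used for `t` promotions of `A` and then for `k - t` promotions of the
result; complementing twice is the identity. -/
theorem IsChain.iterate_rectangle (hA : IsChain k A) (htop : A k = rectangleRows m n) :
    (SSYTPromotion.chainPromotion k)^[k] A = A := by
  have outside : ∀ B : ℕ → ℕ → ℤ, IsChain k B → B k = rectangleRows m n → ∀ t r, m ≤ r →
      B t r = 0 := by
    intro B hB hBtop t r hr
    have a := hB.nonneg t r
    have b := hB.mono r (Nat.le_max_left t k)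
    simp only [hB.const _ (Nat.le_max_right t k), hBtop, rectangleRows,
      if_neg (Nat.not_lt.2 hr)] at b
    omega
  have key : ∀ i ≤ k, ∀ r < m, ∀ B : ℕ → ℕ → ℤ, IsChain k B → B k = rectangleRows m n →
      (SSYTPromotion.chainPromotion k)^[i] B (k - i) r = n - B i (m - 1 - r) := by
    intro i hi r hr B hB hBtop
    have := hB.evacuation_rectangle hBtop (t := k - i) (by omega) hr
    rwa [chainEvacuation_apply (i := i) (by omega), Nat.sub_sub_self hi] at this
  funext t r
  have hk := hA.iterate k
  have hktop := (hA.iterate_apply_top k).trans htop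
  rcases Nat.lt_or_ge r m with hr | hr
  · rcases Nat.le_total t k with ht | ht
    · have a := key t ht (m - 1 - r) (by omega) A hA htop
      have b := key (k - t) (by omega) r hr _ (hA.iterate t) ((hA.iterate_apply_top t).trans htop)
      rw [← Function.iterate_add_apply, Nat.sub_add_cancel ht, Nat.sub_sub_self ht, a] at b
      rw [b, (by omega : m - 1 - (m - 1 - r) = r)]
      ring
    · rw [hk.const t ht, hA.const t ht, hktop, htop]
  · rw [outside A hA htop t r hr, outside _ hk hktop t r hr]

end SSYTPromotion

/-! ### The effect of one slide on chains of shapes -/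

namespace SSYTPromotion

variable {k : ℕ} {A C : ℕ → ℕ → ℤ}

theorem HStrip.toggle_eq_left {α β : ℕ → ℤ} (h : HStrip α β) : toggle α β β = α := by
  conv_lhs => rw [← h.toggle_self, h.toggle_self]
  conv_lhs => arg 2; rw [← h.toggle_self]
  exact toggle_toggle α α β

/-- `C` is the chain of shapes obtained from the chain `A` by slides into boxes of `A 1`. -/
structure IsSlid (A C : ℕ → ℕ → ℤ) : Prop where
  zero : C 0 = 0
  strip : HStrip 0 (C 1)
  le : HStrip (C 1) (A 1)
  toggle : ∀ t, C (t + 2) = toggle (C (t + 1)) (A (t + 1)) (A (t + 2))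

theorem IsChain.isSlid_self (hA : IsChain k A) : IsSlid A A where
  zero := hA.zero
  strip := hA.zero ▸ hA.strip 0
  le := hA.hstrip_self 1
  toggle t := (hA.strip (t + 1)).toggle_self.symm

theorem IsSlid.hstrip (h : IsSlid A C) (hA : IsChain k A) :
    ∀ t, HStrip (C (t + 1)) (A (t + 1))
  | 0 => h.le
  | t + 1 => by
    rw [h.toggle t]
    exact (h.hstrip hA t).toggle_right (hA.strip _)

theorem IsSlid.isChain (h : IsSlid A C) (hA : IsChain k A) (hk : 0 < k) : IsChain k C where
  zero := h.zero
  strip t := by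
    rcases t with _ | t
    · rw [h.zero]
      exact h.strip
    · rw [h.toggle t]
      exact (h.hstrip hA t).toggle_left (hA.strip _)
  const t ht := by
    induction t, ht using Nat.le_induction with
    | base => rfl
    | succ t ht ih =>
      obtain ⟨t, rfl⟩ : ∃ s, t = s + 1 := ⟨t - 1, by omega⟩
      have e : A (t + 2) = A (t + 1) := by rw [hA.const _ ht, hA.const _ (by omega)]
      rw [h.toggle t, e, (h.hstrip hA t).toggle_eq_left, ih]

/-- The row of the hole after a slide has passed all letters up to `t`, if the slide starts
in the row `0` of the tableau with the chain `C` of shapes. -/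
def holeRow (C : ℕ → ℕ → ℤ) : ℕ → ℕ
  | 0 => 0
  | t + 1 => if 0 < t ∧ C t (holeRow C t) ≤ C (t + 1) (holeRow C t + 1) then holeRow C t + 1
    else holeRow C t

/-- The chain of shapes after a slide that starts in the row `0`. -/
def slideChain (C : ℕ → ℕ → ℤ) : ℕ → ℕ → ℤ
  | 0 => 0
  | t + 1 => fun r => if r = holeRow C (t + 1) then C (t + 1) r - 1 else C (t + 1) r

theorem holeRow_one (C : ℕ → ℕ → ℤ) : holeRow C 1 = 0 := by simp [holeRow]

theorem monotone_holeRow (C : ℕ → ℕ → ℤ) : Monotone (holeRow C) :=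
  monotone_nat_of_le_succ fun t => by
    rw [holeRow]
    split_ifs <;> omega

theorem IsSlid.row_succ (h : IsSlid A C) (hA : IsChain k A) (r : ℕ) :
    C 1 (r + 1) = 0 ∧ A 1 (r + 1) = 0 := by
  have a := h.strip r
  have b := h.strip (r + 1)
  have c := hA.strip 0 r
  have d := hA.strip 0 (r + 1)
  simp only [hA.zero, Pi.zero_apply, zero_add] at a b c d
  omega

/-- The hole is never below a row in which the shape has changed. -/
theorem IsSlid.eq_of_holeRow_lt (h : IsSlid A C) (hA : IsChain k A) (t q : ℕ)
    (hq : holeRow C (t + 1) < q) : C (t + 1) q = A (t + 1) q := by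
  induction t generalizing q with
  | zero =>
    obtain ⟨q, rfl⟩ : ∃ r, q = r + 1 := ⟨q - 1, by omega⟩
    rw [zero_add, (h.row_succ hA q).1, (h.row_succ hA q).2]
  | succ t ih =>
    obtain ⟨q, rfl⟩ : ∃ r, q = r + 1 := ⟨q - 1, by omega⟩
    have hmono : holeRow C (t + 1) ≤ holeRow C (t + 2) := monotone_holeRow C (by omega)
    simp only [add_assoc, Nat.reduceAdd] at hq
    have e := ih (q + 1) (by omega)
    have a := (hA.strip (t + 1) (q + 1)).2
    have b := (hA.strip (t + 1) q).2
    have T : C (t + 2) (q + 1) = min (C (t + 1) q) (A (t + 2) (q + 1)) +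
        max (C (t + 1) (q + 1)) (A (t + 2) (q + 2)) - A (t + 1) (q + 1) := by
      rw [h.toggle t, SSYTPromotion.toggle]
    simp only [add_assoc, Nat.reduceAdd] at *
    rcases Nat.lt_or_ge (holeRow C (t + 1)) q with h1 | h1
    · have := ih q h1
      omega
    · have h2 : holeRow C (t + 2) = q := by omega
      have h3 : holeRow C (t + 1) = q := by omega
      have h4 : ¬ (C (t + 1) q ≤ C (t + 2) (q + 1)) := by
        intro h4
        rw [holeRow, h3, if_pos ⟨by omega, h4⟩] at h2
        omega
      omega

/-- Removing a box from row `ρ` of the first argument lowers the toggle by one box: in row `ρ + 1`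
if the `min` term drops, in row `ρ` if the `max` term drops. This is the dichotomy that defines
`holeRow`. -/
theorem IsSlid.slideChain (h : IsSlid A C) (hA : IsChain k A) (h0 : 0 < C 1 0) :
    IsSlid A (slideChain C) where
  zero := rfl
  strip := by
    intro r
    have a := (h.row_succ hA r).1
    have b := h.strip r
    simp only [SSYTPromotion.slideChain, holeRow_one, zero_add, Pi.zero_apply] at *
    split_ifs with h1 <;> first | omega | (subst h1; omega)
  le := by
    intro r
    have a := h.row_succ hA r
    have b := h.le r
    have c := h.strip r
    simp only [SSYTPromotion.slideChain, holeRow_one, zero_add, Pi.zero_apply] at *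
    split_ifs with h1 <;> first | omega | (subst h1; omega)
  toggle t := by
    have inv := h.eq_of_holeRow_lt hA t
    have T := h.toggle t
    have hA' := hA.strip (t + 1)
    have hC := h.hstrip hA t
    -- Below the hole `C (t + 1)` agrees with `A (t + 1)`, so the toggle gives `C (t + 2) (ρ + 1) =
    -- min (C (t + 1) ρ) (A (t + 2) (ρ + 1))`, where `ρ` is the row of the hole.
    have key : C (t + 1) (holeRow C (t + 1)) ≤ C (t + 2) (holeRow C (t + 1) + 1) ↔
        C (t + 1) (holeRow C (t + 1)) ≤ A (t + 2) (holeRow C (t + 1) + 1) := by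
      have e := inv (holeRow C (t + 1) + 1) (by omega)
      have a := (hA' (holeRow C (t + 1) + 1)).2
      rw [T, SSYTPromotion.toggle]
      simp only [add_assoc, Nat.reduceAdd] at *
      omega
    have hrow : holeRow C (t + 2) = if C (t + 1) (holeRow C (t + 1)) ≤
        A (t + 2) (holeRow C (t + 1) + 1) then holeRow C (t + 1) + 1 else holeRow C (t + 1) := by
      rw [holeRow]
      simp only [Nat.succ_pos, true_and, key]
    simp only [SSYTPromotion.slideChain, hrow]
    generalize holeRow C (t + 1) = ρ at *
    generalize C (t + 1) = α at *
    generalize A (t + 1) = β at *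
    generalize A (t + 2) = δ at *
    rw [T]
    clear T hrow key inv h hA
    funext r
    rcases r with _ | r <;> simp only [SSYTPromotion.toggle] <;> grind

/-! ### The jeu de taquin path of one slide -/

/-- The tableau `f` on the set `sh` of boxes has the chain `A` of shapes. -/
def Encodes (sh : Finset (ℕ × ℕ)) (f : ℕ → ℕ → ℕ) (A : ℕ → ℕ → ℤ) : Prop :=
  ∀ t i j, ((i, j) ∈ sh ∧ f i j ≤ t) ↔ (j : ℤ) < A t i

variable {sh : Finset (ℕ × ℕ)} {g : ℕ → ℕ → ℕ}

theorem slidePath_of_none {b : ℕ × ℕ} (h : nextBox sh g b = none) : slidePath sh g b = [b] := by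
  rw [slidePath]
  split
  · rfl
  · simp_all

theorem slidePath_of_some {b c : ℕ × ℕ} (h : nextBox sh g b = some c) :
    slidePath sh g b = b :: slidePath sh g c := by
  rw [slidePath]
  split
  · simp_all
  · simp_all

theorem mem_slidePath {b x : ℕ × ℕ} (hx : x ∈ slidePath sh g b) :
    b.1 + b.2 ≤ x.1 + x.2 ∧ (b ∈ sh → x ∈ sh) := by
  induction b using slidePath.induct sh g with
  | case1 b h =>
    rw [slidePath_of_none h, List.mem_singleton] at hx
    subst hx
    exact ⟨le_rfl, id⟩
  | case2 b c h ih =>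
    rw [slidePath_of_some h, List.mem_cons] at hx
    rcases hx with rfl | hx
    · exact ⟨le_rfl, id⟩
    · have := nextBox_spec h
      exact ⟨this.2.le.trans (ih hx).1, fun _ => (ih hx).2 this.1⟩

/-- After the slide that starts at `b`, the box `x` belongs to the tableau, with an entry that is at
most `s`. -/
def SlidLE (sh : Finset (ℕ × ℕ)) (g : ℕ → ℕ → ℕ) (b : ℕ × ℕ) (s : ℕ) (x : ℕ × ℕ) : Prop :=
  (x ∈ slidePath sh g b ∧ ∃ c, nextBox sh g x = some c ∧ g c.1 c.2 ≤ s) ∨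
    (x ∉ slidePath sh g b ∧ x ∈ sh ∧ g x.1 x.2 ≤ s)

theorem slidLE_of_none {b x : ℕ × ℕ} {s : ℕ} (h : nextBox sh g b = none) :
    SlidLE sh g b s x ↔ x ≠ b ∧ x ∈ sh ∧ g x.1 x.2 ≤ s := by
  rw [SlidLE, slidePath_of_none h]
  simp only [List.mem_singleton]
  constructor
  · rintro (⟨rfl, c, hc, -⟩ | h')
    · simp [h] at hc
    · exact h'
  · exact .inr

theorem slidLE_of_some {b c x : ℕ × ℕ} {s : ℕ} (h : nextBox sh g b = some c) :
    SlidLE sh g b s x ↔ (x = b ∧ g c.1 c.2 ≤ s) ∨ (x ≠ b ∧ SlidLE sh g c s x) := by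
  rw [SlidLE, SlidLE, slidePath_of_some h]
  have hb : b ∉ slidePath sh g c := fun hb => by
    have := (mem_slidePath hb).1
    have := (nextBox_spec h).2
    omega
  by_cases hx : x = b
  · subst hx
    simp [h]
  · simp [hx]

theorem slide_spec {inner : Finset (ℕ × ℕ)} {b : ℕ × ℕ} (hb : b ∈ sh) (s i j : ℕ) :
    ((i, j) ∈ (slide ⟨sh, inner, g⟩ b).outer ∧ (slide ⟨sh, inner, g⟩ b).entry i j ≤ s) ↔
      SlidLE sh g b s (i, j) := by
  simp only [slide, SlidLE, Finset.mem_filter]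
  by_cases hx : (i, j) ∈ slidePath sh g b
  · have := (mem_slidePath hx).2 hb
    rcases h : nextBox sh g (i, j) with _ | c <;> simp [hx, this]
  · simp [hx]

/-- The hole after a slide has passed all letters up to `t`. -/
def hole (C : ℕ → ℕ → ℤ) (t : ℕ) : ℕ × ℕ :=
  (holeRow C t, (C t (holeRow C t) - 1).toNat)

theorem IsChain.le_top (hC : IsChain k C) (t r : ℕ) : C t r ≤ C k r := by
  have : C t r ≤ C (max t k) r := hC.mono r (Nat.le_max_left t k)
  rwa [hC.const _ (Nat.le_max_right t k)] at this

theorem hole_corner (hC' : IsChain k (slideChain C)) (t : ℕ) :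
    0 < C (t + 1) (holeRow C (t + 1)) ∧
      C (t + 1) (holeRow C (t + 1) + 1) < C (t + 1) (holeRow C (t + 1)) := by
  have a := hC'.nonneg (t + 1) (holeRow C (t + 1))
  have b : slideChain C (t + 1) (holeRow C (t + 1) + 1) ≤ slideChain C (t + 1) (holeRow C (t + 1)) :=
    hC'.antitone (t + 1) (by omega)
  simp only [slideChain, if_true] at a b
  rw [if_neg (by omega)] at b
  exact ⟨by omega, by omega⟩

theorem hole_snd (hC' : IsChain k (slideChain C)) (t : ℕ) :
    ((hole C (t + 1)).2 : ℤ) = C (t + 1) (holeRow C (t + 1)) - 1 := by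
  have := (hole_corner hC' t).1
  simp only [hole]
  omega

theorem hole_const (hC : IsChain k C) (hC' : IsChain k (slideChain C)) (hk : 0 < k) {t : ℕ}
    (ht : k ≤ t) : hole C t = hole C k := by
  have e : holeRow C t = holeRow C k := by
    induction t, ht using Nat.le_induction with
    | base => rfl
    | succ t ht ih =>
      obtain ⟨t, rfl⟩ : ∃ s, t = s + 1 := ⟨t - 1, by omega⟩
      have := (hole_corner hC' t).2
      rw [holeRow, if_neg, ih]
      rw [hC.const (t + 1 + 1) (by omega), ← hC.const (t + 1) ht]
      omega
  rw [hole, hole, e, hC.const t ht]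

/-- The entry below is at most `t + 2`. The box to the right lies outside `C (t + 1)`, so its entry,
if any, is at least `t + 2`; a tie goes down. -/
theorem nextBox_hole_down (h : Encodes sh g C) (hC' : IsChain k (slideChain C)) {t : ℕ}
    (ht : C (t + 1) (holeRow C (t + 1)) ≤ C (t + 2) (holeRow C (t + 1) + 1)) :
    nextBox sh g (hole C (t + 1)) = some ((hole C (t + 1)).1 + 1, (hole C (t + 1)).2) := by
  have e := hole_snd hC' t
  have a := (h (t + 2) ((hole C (t + 1)).1 + 1) (hole C (t + 1)).2).2 (by
    change _ < C (t + 2) (holeRow C (t + 1) + 1)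
    omega)
  have b := h (t + 1) (hole C (t + 1)).1 ((hole C (t + 1)).2 + 1)
  change _ ↔ _ < C (t + 1) (holeRow C (t + 1)) at b
  rw [nextBox, if_pos a.1]
  split_ifs with h1 h2
  · rfl
  · refine absurd (b.1 ⟨h1, ?_⟩) ?_
    · omega
    · push_cast
      omega
  · rfl

theorem nextBox_right (h : Encodes sh g C) {t r j : ℕ} (h₁ : C (t + 1) (r + 1) ≤ j)
    (h₂ : (j : ℤ) + 1 < C (t + 1) r) : nextBox sh g (r, j) = some (r, j + 1) := by
  have a := (h (t + 1) r (j + 1)).2 (by push_cast; exact h₂)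
  have b := h (t + 1) (r + 1) j
  rw [nextBox]
  simp only [a.1, if_true]
  split_ifs with h1 h2
  · exact absurd (b.1 ⟨h1, h2.trans a.2⟩) (by omega)
  · rfl
  · rfl

theorem nextBox_hole_top (h : Encodes sh g C) (hC : IsChain k C)
    (hC' : IsChain k (slideChain C)) (hk : 0 < k) : nextBox sh g (hole C k) = none := by
  obtain ⟨k, rfl⟩ : ∃ s, k = s + 1 := ⟨k - 1, by omega⟩
  have e := hole_snd hC' k
  have c := (hole_corner hC' k).2
  rw [nextBox, if_neg, if_neg]
  · intro hm
    have a := (h _ _ _).1 ⟨hm, le_rfl⟩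
    have b := hC.le_top (g (hole C (k + 1)).1 ((hole C (k + 1)).2 + 1)) (hole C (k + 1)).1
    change _ ≤ C (k + 1) (holeRow C (k + 1)) at b
    push_cast at a
    omega
  · intro hm
    have a := (h _ _ _).1 ⟨hm, le_rfl⟩
    have b := hC.le_top (g ((hole C (k + 1)).1 + 1) (hole C (k + 1)).2) ((hole C (k + 1)).1 + 1)
    change _ ≤ C (k + 1) (holeRow C (k + 1) + 1) at b
    omega

theorem Encodes.entry_le_iff (h : Encodes sh g C) (hC : IsChain k C) {t i j : ℕ}
    (h₁ : C t i ≤ j) (h₂ : (j : ℤ) < C (t + 1) i) (s : ℕ) : g i j ≤ s ↔ t + 1 ≤ s := by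
  have hm := ((h _ _ _).2 h₂).1
  constructor
  · intro hs
    by_contra hc
    have a := (h s i j).1 ⟨hm, hs⟩
    have b : C s i ≤ C t i := hC.mono i (by omega)
    omega
  · intro hs
    have b : C (t + 1) i ≤ C s i := hC.mono i hs
    exact ((h s i j).2 (by omega)).2

/-- Downward induction on `t`, from the end of the path, where no letters are left to pass. To pass
the letter `t + 2`, the hole either drops one row or runs right past all the `t + 2` in its row. -/
theorem slidLE_hole (h : Encodes sh g C) (hC : IsChain k C) (hC' : IsChain k (slideChain C))
    {t : ℕ} (ht : t + 1 ≤ k) (s : ℕ) (x : ℕ × ℕ) : SlidLE sh g (hole C (t + 1)) s x ↔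
      (x.2 : ℤ) < C s x.1 ∧ x ≠ hole C (max s (t + 1)) := by
  obtain ⟨d, hd⟩ := Nat.exists_eq_add_of_le ht
  induction d generalizing t s x with
  | zero =>
    obtain rfl : k = t + 1 := hd
    rw [slidLE_of_none (nextBox_hole_top h hC hC' (by omega)), ← h s x.1 x.2,
      hole_const hC hC' (by omega) (Nat.le_max_right s (t + 1)), and_comm]
  | succ d ih =>
    have ih : ∀ (s : ℕ) (x : ℕ × ℕ), SlidLE sh g (hole C (t + 2)) s x ↔
        (x.2 : ℤ) < C s x.1 ∧ x ≠ hole C (max s (t + 2)) :=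
      fun s x => ih (t := t + 1) (by omega) s x (by omega)
    have snd := hole_snd hC' t
    have snd' : ((hole C (t + 2)).2 : ℤ) = C (t + 2) (holeRow C (t + 2)) - 1 := hole_snd hC' (t + 1)
    have cor := hole_corner hC' t
    have hstrip : HStrip (C (t + 1)) (C (t + 2)) := hC.strip (t + 1)
    have fst : ∀ t, (hole C t).1 = holeRow C t := fun _ => rfl
    by_cases hdown : C (t + 1) (holeRow C (t + 1)) ≤ C (t + 2) (holeRow C (t + 1) + 1)
    · have hrow : holeRow C (t + 2) = holeRow C (t + 1) + 1 := by
        rw [holeRow, if_pos ⟨by omega, hdown⟩]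
      have heq := (hstrip (holeRow C (t + 1))).2
      have hnext : ((hole C (t + 1)).1 + 1, (hole C (t + 1)).2) = hole C (t + 2) := by
        refine Prod.ext hrow.symm ?_
        zify
        rw [snd, snd', hrow]
        omega
      rw [hrow] at snd'
      rw [slidLE_of_some ((nextBox_hole_down h hC' hdown).trans (congrArg some hnext)), ih,
        h.entry_le_iff hC (t := t + 1) (by rw [fst, hrow]; omega)
          (by rw [fst, hrow]; show _ < C (t + 2) _; omega)]
      rcases Nat.lt_or_ge s (t + 2) with hs | hs
      · rw [max_eq_right hs.le, max_eq_right (by omega : s ≤ t + 1)]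
        have hne : (x.2 : ℤ) < C s x.1 → x ≠ hole C (t + 2) := by
          rintro hx rfl
          have : C s (hole C (t + 2)).1 ≤ C (t + 1) (hole C (t + 2)).1 := hC.mono _ (by omega)
          rw [fst, hrow] at this hx
          omega
        constructor
        · rintro (⟨-, h1⟩ | ⟨h1, h2, -⟩)
          · omega
          · exact ⟨h2, h1⟩
        · rintro ⟨h1, h2⟩
          exact .inr ⟨h2, h1, hne h1⟩
      · rw [max_eq_left hs, max_eq_left (by omega : t + 1 ≤ s)]
        by_cases hx : x = hole C (t + 1)
        · subst hx
          have a : C (t + 1) (holeRow C (t + 1)) ≤ C s (holeRow C (t + 1)) :=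
            hC.mono _ (by omega)
          have b : hole C (t + 1) ≠ hole C s := fun e => by
            have := congrArg Prod.fst e
            have := monotone_holeRow C hs
            simp only [fst] at *
            omega
          simp only [true_and, ne_eq, not_true_eq_false, false_and, or_false, b,
            not_false_eq_true, and_true]
          rw [fst]
          exact iff_of_true hs (by omega)
        · simp [hx]
    · have hrow : holeRow C (t + 2) = holeRow C (t + 1) := by
        rw [holeRow, if_neg fun h => hdown h.2]
      -- Here `e` counts the letters `t + 2` still to the right of the hole.
      have right : ∀ e j : ℕ, C (t + 1) (holeRow C (t + 1)) ≤ (j : ℤ) + 1 →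
          (j : ℤ) + 1 + e = C (t + 2) (holeRow C (t + 1)) → ∀ (s : ℕ) (x : ℕ × ℕ),
          (SlidLE sh g (holeRow C (t + 1), j) s x ↔ (x.2 : ℤ) < C s x.1 ∧
            x ≠ if s ≤ t + 1 then (holeRow C (t + 1), j) else hole C s) := by
        intro e
        induction e with
        | zero =>
          intro j hj hj' s x
          have e : (holeRow C (t + 1), j) = hole C (t + 2) := by
            refine Prod.ext hrow.symm ?_
            zify
            rw [snd', hrow]
            omega
          rw [e, ih]
          split_ifs with hs
          · rw [max_eq_right (by omega)]
          · rw [max_eq_left (by omega)]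
        | succ e ihe =>
          intro j hj hj' s x
          rw [slidLE_of_some (nextBox_right h (t := t + 1) (by show C (t + 2) _ ≤ _; omega)
            (by show _ < C (t + 2) _; omega)), ihe (j + 1) (by push_cast; omega) (by push_cast; omega),
            h.entry_le_iff hC (t := t + 1) (by push_cast; omega)
              (by show _ < C (t + 2) _; push_cast; omega)]
          split_ifs with hs
          · have hne : (x.2 : ℤ) < C s x.1 → x ≠ (holeRow C (t + 1), j + 1) := by
              rintro hx rfl
              have : C s (holeRow C (t + 1)) ≤ C (t + 1) (holeRow C (t + 1)) := hC.mono _ hs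
              push_cast at hx
              omega
            constructor
            · rintro (⟨-, h1⟩ | ⟨h1, h2, -⟩)
              · omega
              · exact ⟨h2, h1⟩
            · rintro ⟨h1, h2⟩
              exact .inr ⟨h2, h1, hne h1⟩
          · by_cases hx : x = (holeRow C (t + 1), j)
            · subst hx
              have a : C (t + 2) (holeRow C (t + 1)) ≤ C s (holeRow C (t + 1)) :=
                hC.mono _ (by omega)
              have b : (holeRow C (t + 1), j) ≠ hole C s := fun e => by
                have e1 := congrArg Prod.fst e
                have e2 := congrArg Prod.snd e
                obtain ⟨s, rfl⟩ : ∃ s', s = s' + 1 := ⟨s - 1, by omega⟩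
                have := hole_snd hC' s
                simp only [fst] at *
                rw [← e1] at this
                omega
              simp only [true_and, ne_eq, not_true_eq_false, false_and, or_false, b,
                not_false_eq_true, and_true]
              exact iff_of_true (by omega) (by omega)
            · simp [hx]
      have hle := (hstrip (holeRow C (t + 1))).1
      have := right (C (t + 2) (holeRow C (t + 1)) - C (t + 1) (holeRow C (t + 1))).toNat
        (hole C (t + 1)).2 (by omega) (by omega) s x
      refine this.trans ?_
      split_ifs with hs
      · rw [max_eq_right hs]
        rfl
      · rw [max_eq_left (by omega)]

/-- A slide that starts in the row `0` has the expected effect on the chain of shapes. -/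
theorem Encodes.slide (h : Encodes sh g C) (hC : IsChain k C) (hC' : IsChain k (slideChain C))
    (hk : 0 < k) (inner : Finset (ℕ × ℕ)) :
    Encodes (slide ⟨sh, inner, g⟩ (hole C 1)).outer (slide ⟨sh, inner, g⟩ (hole C 1)).entry
      (slideChain C) := by
  have e := hole_snd hC' 0
  have hm : hole C 1 ∈ sh := ((h 1 (hole C 1).1 (hole C 1).2).2 (by
    change _ < C 1 (holeRow C 1)
    rw [zero_add] at e
    omega)).1
  intro s i j
  rw [slide_spec hm, slidLE_hole h hC hC' (t := 0) hk]
  rcases s with _ | s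
  · simp [hC.zero, slideChain]
  · rw [max_eq_left (by omega)]
    have e := hole_snd hC' s
    simp only [slideChain]
    constructor
    · rintro ⟨h1, h2⟩
      split_ifs with hi
      · subst hi
        refine lt_of_le_of_ne (by omega) fun he => h2 ?_
        refine Prod.ext rfl ?_
        zify
        rw [e]
        exact he
      · exact h1
    · intro h1
      split_ifs at h1 with hi
      · subst hi
        refine ⟨by omega, fun he => ?_⟩
        have := congrArg Prod.snd he
        simp only at this
        omega
      · exact ⟨h1, fun he => hi (congrArg Prod.fst he)⟩

end SSYTPromotion

/-! ### Promotion and evacuation of tableaux in terms of chains -/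

namespace SSYTPromotion

variable {k : ℕ} {A C : ℕ → ℕ → ℤ} {sh : Finset (ℕ × ℕ)} {f g : ℕ → ℕ → ℕ}

theorem le_lastBox (s : Finset (ℕ × ℕ)) (h : s.Nonempty) {x : ℕ × ℕ} (hx : x ∈ s) :
    toLex x ≤ toLex (lastBox s h) := by
  unfold lastBox
  rw [toLex_ofLex]
  exact Finset.le_max' (s.map toLex.toEmbedding) (toLex x) (Finset.mem_map_of_mem _ hx)

theorem IsSlid.lastBox_eq (h : IsSlid A C) (hA : IsChain k A) {inner : Finset (ℕ × ℕ)}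
    (hinner : ∀ x : ℕ × ℕ, x ∈ inner ↔ (x.2 : ℤ) < C 1 x.1) (hne : inner.Nonempty) :
    lastBox inner hne = hole C 1 := by
  have a := (hinner _).1 (lastBox_mem inner hne)
  have row : ∀ x ∈ inner, x.1 = 0 := by
    intro x hx
    by_contra hc
    obtain ⟨r, hr⟩ := Nat.exists_eq_succ_of_ne_zero hc
    have := (hinner x).1 hx
    rw [hr, (h.row_succ hA r).1] at this
    omega
  have hrow := row _ (lastBox_mem inner hne)
  rw [hrow] at a
  have hm : (0, (C 1 0 - 1).toNat) ∈ inner := (hinner _).2 (by simp only; omega)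
  have b := le_lastBox inner hne hm
  rw [Prod.Lex.toLex_le_toLex, hrow] at b
  refine Prod.ext (by rw [hrow, hole, holeRow_one]) ?_
  simp only [hole, holeRow_one]
  omega

/-- The rectification that occurs in promotion, in terms of chains of shapes. -/
theorem exists_rectify (hA : IsChain k A) (hk : 0 < k) (N : ℕ) (hC : IsSlid A C)
    (h : Encodes sh g C) (hN : C 1 0 = N) {inner : Finset (ℕ × ℕ)}
    (hinner : ∀ x : ℕ × ℕ, x ∈ inner ↔ (x.2 : ℤ) < C 1 x.1) :
    ∃ C', IsSlid A C' ∧ C' 1 = 0 ∧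
      Encodes (rectify ⟨sh, inner, g⟩).outer (rectify ⟨sh, inner, g⟩).entry C' := by
  induction N generalizing C sh g inner with
  | zero =>
    have h1 : C 1 = 0 := by
      funext r
      rcases r with _ | r
      · exact hN
      · exact (hC.row_succ hA r).1
    have hempty : ¬ inner.Nonempty := by
      rintro ⟨x, hx⟩
      have := (hinner x).1 hx
      rw [h1, Pi.zero_apply] at this
      omega
    rw [rectify, dif_neg hempty]
    exact ⟨C, hC, h1, h⟩
  | succ N ih =>
    have hpos : 0 < C 1 0 := by omega
    have hne : inner.Nonempty := ⟨(0, 0), (hinner _).2 (by simpa using hpos)⟩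
    have hC' := hC.slideChain hA hpos
    rw [rectify, dif_pos hne, hC.lastBox_eq hA hinner hne]
    have hch := hC.isChain hA hk
    have hch' := hC'.isChain hA hk
    refine ih hC' (h.slide hch hch' hk inner) ?_ ?_
    · simp only [slideChain, holeRow_one, zero_add, if_true]
      push_cast at hN
      omega
    · intro x
      have e : ((hole C 1).2 : ℤ) = C 1 (holeRow C 1) - 1 := hole_snd hch' 0
      have e1 : (hole C 1).1 = 0 := holeRow_one C
      rw [holeRow_one] at e
      change x ∈ inner.erase _ ↔ _
      rw [Finset.mem_erase, hinner]
      simp only [slideChain, zero_add, holeRow_one]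
      have hx : x ≠ hole C 1 ↔ ¬ (x.1 = 0 ∧ x.2 = (hole C 1).2) := by
        rw [Ne, Prod.ext_iff, e1]
      rw [hx]
      split_ifs with h0
      · rw [h0]
        omega
      · simp [h0]

theorem Encodes.promotion (h : Encodes sh f A) (hA : IsChain k A) :
    Encodes sh (promotion k sh f) (chainPromotion k A) := by
  have hP := hA.chainPromotion
  have htop : ∀ t i, chainPromotion k A t i ≤ A k i := fun t i => by
    rw [← hA.chainPromotion_of_le le_rfl]
    exact hP.le_top t i
  rcases Nat.eq_zero_or_pos k with rfl | hk
  · have zero : ∀ t i, A t i ≤ 0 := fun t i => by simpa [hA.zero] using hA.le_top t i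
    intro t i j
    refine iff_of_false (fun hc => ?_) (fun hc => ?_)
    · have := (h _ i j).1 ⟨hc.1, le_rfl⟩
      have := zero (f i j) i
      omega
    · have := htop t i
      have := zero 0 i
      omega
  obtain ⟨C, hC, hC1, hE⟩ := exists_rectify (inner := sh.filter fun c => f c.1 c.2 = 1) hA hk
    (A 1 0).toNat hA.isSlid_self h (by have := hA.nonneg 1 0; omega) (by
      intro x
      rw [← h 1 x.1 x.2, Finset.mem_filter]
      refine and_congr_right fun hx => ⟨fun e => e.le, fun e => ?_⟩
      refine le_antisymm e (Nat.one_le_iff_ne_zero.2 fun h0 => ?_)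
      have := (h 0 x.1 x.2).1 ⟨hx, h0.le⟩
      rw [hA.zero, Pi.zero_apply] at this
      omega)
  have hch := hC.isChain hA hk
  have hCA : ∀ t i, C t i ≤ A t i := by
    intro t i
    rcases t with _ | t
    · rw [hC.zero, hA.zero]
    · exact (hC.hstrip hA t i).1
  -- With `C 1 = 0` the recursion of `IsSlid` is that of promotion, shifted by one letter; the shift
  -- is the decrement of the entries.
  have hCP : ∀ t < k, C (t + 1) = chainPromotion k A t := by
    intro t
    induction t with
    | zero => exact fun _ => hC1
    | succ t ih =>
      intro ht
      rw [hC.toggle t, ih (by omega), chainPromotion_succ ht]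
  have hsh : ∀ i j, (i, j) ∈ sh ↔ (j : ℤ) < A k i := by
    intro i j
    refine ⟨fun hm => ?_, fun hj => ((h k i j).2 hj).1⟩
    exact ((h _ i j).1 ⟨hm, le_rfl⟩).trans_le (hA.le_top _ i)
  intro t i j
  rw [SSYTPromotion.promotion]
  generalize rectify _ = R at *
  by_cases hR : (i, j) ∈ R.outer
  · have e := (hE _ i j).1 ⟨hR, le_rfl⟩
    have e1 := e.trans_le (hch.le_top _ i)
    have ek := ((hE k i j).2 e1).2
    have hm : (i, j) ∈ sh := (hsh i j).2 (e1.trans_le (hCA k i))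
    -- No 1 is left, so the truncated subtraction is a true one and no entry becomes 0.
    have e2 : ¬ R.entry i j ≤ 1 := fun hc => by
      have := (hE 1 i j).1 ⟨hR, hc⟩
      rw [hC1, Pi.zero_apply] at this
      omega
    simp only [hR, if_true, hm, true_and]
    rcases Nat.lt_or_ge t k with ht | ht
    · rw [← hCP t ht, ← hE (t + 1) i j]
      simp only [hR, true_and]
      omega
    · rw [hA.chainPromotion_of_le ht, ← hsh]
      exact iff_of_true (by omega) hm
  · simp only [hR, if_false]
    by_cases hm : (i, j) ∈ sh
    · simp only [hm, if_true, true_and]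
      rcases Nat.lt_or_ge t k with ht | ht
      · refine iff_of_false (by omega) fun hc => hR ?_
        rw [← hCP t ht, ← hE (t + 1) i j] at hc
        exact hc.1
      · rw [hA.chainPromotion_of_le ht, ← hsh]
        exact iff_of_true ht hm
    · refine iff_of_false (fun hc => hm hc.1) fun hc => hm ?_
      rw [hsh]
      exact hc.trans_le (htop t i)

theorem rectify_outer_subset (S : SkewFilling) : (rectify S).outer ⊆ S.outer := by
  induction S using rectify.induct with
  | case1 S h ih =>
    rw [rectify, dif_pos h]
    exact ih.trans (Finset.filter_subset _ _)
  | case2 S h => rw [rectify, dif_neg h]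

theorem promotion_eq_zero {i j : ℕ} (hm : (i, j) ∉ sh) : promotion k sh f i j = 0 := by
  rw [promotion]
  simp only [if_neg hm]
  exact if_neg fun h => hm (rectify_outer_subset _ h)

/-- Below its ceiling `i`, promotion looks only at shapes up to `i`, so freezing larger entries does
not alter it. -/
theorem chainPromotion_congr {i k : ℕ} {B A : ℕ → ℕ → ℤ} (hik : i ≤ k)
    (h : ∀ t ≤ i, B t = A t) {t : ℕ} (ht : t < i) :
    chainPromotion i B t = chainPromotion k A t := by
  induction t with
  | zero => rw [chainPromotion, chainPromotion]
  | succ t ih =>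
    rw [chainPromotion_succ ht, chainPromotion_succ (by omega), ih (by omega), h _ (by omega),
      h _ (by omega)]

theorem Encodes.promotionUpTo (h : Encodes sh f A) (hA : IsChain k A) {i : ℕ} (hi : i ≤ k) :
    Encodes sh (promotionUpTo i sh f) fun t => if t < i then chainPromotion k A t else A t := by
  have hB : IsChain i fun t => A (min t i) := by
    refine ⟨by simp [hA.zero], fun t => ?_, fun t ht => by simp [ht]⟩
    rcases Nat.lt_or_ge t i with ht | ht
    · simp only [min_eq_left ht.le, min_eq_left (Nat.succ_le_of_lt ht)]
      exact hA.strip t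
    · simp only [min_eq_right ht, min_eq_right (ht.trans (Nat.le_succ t))]
      exact hA.hstrip_self i
  have hE : Encodes (sh.filter fun c => f c.1 c.2 ≤ i) f fun t => A (min t i) := by
    intro t a b
    rw [← h (min t i) a b, Finset.mem_filter, le_min_iff]
    simp only
    tauto
  have hP := hE.promotion hB
  intro t a b
  have hm : (a, b) ∈ sh.filter (fun c => f c.1 c.2 ≤ i) ↔ (a, b) ∈ sh ∧ f a b ≤ i :=
    Finset.mem_filter
  have e := hP t a b
  rw [hm] at e
  simp only [SSYTPromotion.promotionUpTo, hm]
  split_ifs with h1 h2 h2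
  · rw [← chainPromotion_congr hi (B := fun t => A (min t i))
      (fun t ht => by simp only [min_eq_left ht]) h2, ← e]
    simp [h1]
  · rw [hB.chainPromotion_of_le (Nat.not_lt.1 h2)] at e
    simp only [h1, true_and, min_self] at e ⊢
    have a1 := (h i a b).1 h1
    have a2 : A i a ≤ A t a := hA.mono a (Nat.not_lt.1 h2)
    exact iff_of_true (e.2 a1) (by omega)
  · rw [← chainPromotion_congr hi (B := fun t => A (min t i))
      (fun t ht => by simp only [min_eq_left ht]) h2, ← e]
    refine iff_of_false (fun hc => h1 ⟨hc.1, by omega⟩) (fun hc => h1 hc.1)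
  · exact h t a b

/-- Step `s` has ceiling `k - (s - 1)`, so it promotes shape `t` only while `s ≤ k - t`. -/
theorem IsChain.evacuationStep (hA : IsChain k A) (j : ℕ) :
    IsChain k fun t => (SSYTPromotion.chainPromotion k)^[min j (k - t)] A t where
  zero := (hA.iterate _).zero
  strip t := by
    rcases Nat.lt_or_ge j (k - t) with h | h
    · simp only [min_eq_left h.le, min_eq_left (by omega : j ≤ k - (t + 1))]
      exact (hA.iterate j).strip t
    · rcases Nat.lt_or_ge t k with ht | ht
      · simp only [min_eq_right h, min_eq_right (by omega : k - (t + 1) ≤ j)]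
        rw [(by omega : k - t = k - (t + 1) + 1), Function.iterate_succ_apply']
        exact (hA.iterate _).hstrip_chainPromotion t ht
      · simp only [Nat.sub_eq_zero_of_le ht, Nat.sub_eq_zero_of_le (Nat.le_succ_of_le ht),
          Nat.min_zero]
        exact hA.strip t
  const t ht := by
    simp only [Nat.sub_eq_zero_of_le ht, Nat.sub_self, Nat.min_zero]
    exact hA.const t ht

theorem Encodes.evacuationStep (h : Encodes sh f A) (hA : IsChain k A) (j : ℕ) (hj : j ≤ k) :
    Encodes sh (evacuationStep k sh f j)
      fun t => (chainPromotion k)^[min j (k - t)] A t := by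
  induction j using evacuationStep.induct with
  | case1 => simpa [SSYTPromotion.evacuationStep] using h
  | case2 =>
    have e : (fun t => (chainPromotion k)^[min 1 (k - t)] A t) = chainPromotion k A := by
      funext t
      rcases Nat.lt_or_ge t k with ht | ht
      · rw [min_eq_left (by omega), Function.iterate_one]
      · rw [Nat.sub_eq_zero_of_le ht, Nat.min_zero, hA.chainPromotion_of_le ht,
          Function.iterate_zero_apply, hA.const t ht]
    rw [e]
    exact h.promotion hA
  | case3 j ih =>
    have e : (fun t => (chainPromotion k)^[min (j + 2) (k - t)] A t) = fun t =>
        if t < k - (j + 1) then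
          chainPromotion k (fun t => (chainPromotion k)^[min (j + 1) (k - t)] A t) t
        else (chainPromotion k)^[min (j + 1) (k - t)] A t := by
      funext t
      split_ifs with ht
      · rw [min_eq_left (by omega), Function.iterate_succ_apply',
          ← chainPromotion_congr (i := k - (j + 1)) (B := (chainPromotion k)^[j + 1] A)
            (by omega) (fun _ _ => rfl) ht]
        exact chainPromotion_congr (by omega)
          (fun t ht => by simp only [min_eq_left (by omega : j + 1 ≤ k - t)]) ht
      · rw [min_eq_right (by omega), min_eq_right (by omega)]
    rw [e]
    exact (ih (by omega)).promotionUpTo (hA.evacuationStep (j + 1)) (Nat.sub_le k (j + 1))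

theorem Encodes.evacuation (h : Encodes sh f A) (hA : IsChain k A) :
    Encodes sh (evacuation k sh f) (chainEvacuation k A) := by
  have e := h.evacuationStep hA k le_rfl
  simp only [min_eq_right (Nat.sub_le k _)] at e
  exact e

theorem evacuationStep_eq_zero (hf : ∀ i j, (i, j) ∉ sh → f i j = 0) (s : ℕ) {i j : ℕ}
    (hm : (i, j) ∉ sh) : evacuationStep k sh f s i j = 0 := by
  induction s using evacuationStep.induct with
  | case1 => exact hf i j hm
  | case2 => exact promotion_eq_zero hm
  | case3 s ih =>
    rw [evacuationStep, promotionUpTo]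
    split_ifs with h
    · exact absurd (Finset.mem_of_mem_filter _ h) hm
    · exact ih

theorem Encodes.ext (hf : Encodes sh f A) (hg : Encodes sh g A)
    (hf0 : ∀ i j, (i, j) ∉ sh → f i j = 0) (hg0 : ∀ i j, (i, j) ∉ sh → g i j = 0) : f = g := by
  funext i j
  by_cases hm : (i, j) ∈ sh
  · refine eq_of_forall_ge_iff fun t => ?_
    have := (hf t i j).trans (hg t i j).symm
    simpa [hm] using this
  · rw [hf0 i j hm, hg0 i j hm]

/-! ### Transfer to semistandard tableaux -/

variable {lam : YoungDiagram}

/-- Weak rows make the entries at most `t` an initial segment of each row, and strict columns give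
the horizontal strips. The bounds on the entries become `A 0 = 0` and constancy from `k` on. -/
theorem mem_SSYT_iff : f ∈ SSYT k lam ↔ (∀ i j, (i, j) ∉ lam.cells → f i j = 0) ∧
    ∃ A, IsChain k A ∧ Encodes lam.cells f A := by
  constructor
  · rintro ⟨T, rfl, hT⟩
    refine ⟨fun i j h => T.zeros h, ?_⟩
    have enc : ∀ t i : ℕ, ∃ c : ℕ, ∀ j, ((i, j) ∈ lam.cells ∧ T i j ≤ t) ↔ j < c := by
      intro t i
      by_cases hex : ∃ j, ¬ ((i, j) ∈ lam.cells ∧ T i j ≤ t)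
      · classical
        refine ⟨Nat.find hex, fun j => ⟨fun hj => ?_, fun hj => not_not.1 (Nat.find_min hex hj)⟩⟩
        by_contra hc
        refine Nat.find_spec hex ⟨lam.up_left_mem le_rfl (not_lt.1 hc) hj.1, ?_⟩
        exact (T.row_weak_of_le (not_lt.1 hc) hj.1).trans hj.2
      · push Not at hex
        have := (hex (lam.rowLen i)).1
        rw [YoungDiagram.mem_cells, YoungDiagram.mem_iff_lt_rowLen] at this
        omega
    choose c hc using enc
    refine ⟨fun t i => c t i, ⟨?_, ?_, ?_⟩, fun t i j => by rw [hc, Nat.cast_lt]⟩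
    · funext i
      by_contra h0
      have h0 : 0 < c 0 i := Nat.pos_of_ne_zero fun h => h0 (by simp [h])
      have := (hc 0 i 0).2 h0
      have := hT i 0 this.1
      omega
    · intro t i
      constructor <;> refine Nat.cast_le.2 (le_of_forall_lt fun j hj => ?_)
      · have := (hc t i j).2 hj
        exact (hc (t + 1) i j).1 ⟨this.1, this.2.trans (Nat.le_succ t)⟩
      · have := (hc (t + 1) (i + 1) j).2 hj
        have lt : T i j < T (i + 1) j := T.col_strict (Nat.lt_succ_self i) this.1
        exact (hc t i j).1 ⟨lam.up_left_mem (Nat.le_succ i) le_rfl this.1, by omega⟩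
    · intro t ht
      funext i
      norm_cast
      refine eq_of_forall_lt_iff fun j => ?_
      rw [← hc, ← hc]
      refine and_congr_right fun hm => ?_
      have := (hT i j hm).2
      omega
  · rintro ⟨h0, A, hA, h⟩
    refine ⟨⟨f, ?_, ?_, fun hm => h0 _ _ hm⟩, rfl, ?_⟩
    · intro i j₁ j₂ hj hm
      have := (h _ i j₂).1 ⟨hm, le_rfl⟩
      exact ((h _ i j₁).2 (by omega)).2
    · intro i₁ i₂ j hi hm
      have a := (h _ i₂ j).1 ⟨hm, le_rfl⟩
      have b := hA.antitone (f i₂ j) (Nat.succ_le_of_lt hi)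
      rcases e : f i₂ j with _ | t
      · rw [e, hA.zero, Pi.zero_apply] at a
        omega
      · rw [e] at a b
        have := (hA.strip t i₁).2
        exact Nat.lt_succ_of_le ((h t i₁ j).2 (by rw [Nat.succ_eq_add_one] at b; omega)).2
    · intro i j hm
      have a := (h _ i j).1 ⟨hm, le_rfl⟩
      refine ⟨Nat.one_le_iff_ne_zero.2 fun e => ?_, ((h k i j).2 ?_).2⟩
      · change f i j = 0 at e
        rw [e, hA.zero, Pi.zero_apply] at a
        omega
      · exact a.trans_le (hA.le_top _ i)

theorem exists_chain {T : ℕ → ℕ → ℕ} (hT : T ∈ SSYT k lam) :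
    ∃ A, IsChain k A ∧ Encodes lam.cells T A :=
  (mem_SSYT_iff.1 hT).2

theorem eq_of_encodes {T U : ℕ → ℕ → ℕ} (hT : T ∈ SSYT k lam) (hU : U ∈ SSYT k lam)
    (h₁ : Encodes lam.cells T A) (h₂ : Encodes lam.cells U A) : T = U :=
  h₁.ext h₂ (mem_SSYT_iff.1 hT).1 (mem_SSYT_iff.1 hU).1

theorem mapsTo_promotion : Set.MapsTo (promotion k lam.cells) (SSYT k lam) (SSYT k lam) := by
  intro T hT
  obtain ⟨A, hA, h⟩ := exists_chain hT
  exact mem_SSYT_iff.2 ⟨fun _ _ => promotion_eq_zero, _, hA.chainPromotion, h.promotion hA⟩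

theorem mapsTo_evacuation : Set.MapsTo (evacuation k lam.cells) (SSYT k lam) (SSYT k lam) := by
  intro T hT
  obtain ⟨A, hA, h⟩ := exists_chain hT
  exact mem_SSYT_iff.2 ⟨fun _ _ => evacuationStep_eq_zero (mem_SSYT_iff.1 hT).1 k, _,
    hA.chainEvacuation, h.evacuation hA⟩

theorem evacuation_evacuation {T : ℕ → ℕ → ℕ} (hT : T ∈ SSYT k lam) :
    evacuation k lam.cells (evacuation k lam.cells T) = T := by
  obtain ⟨A, hA, h⟩ := exists_chain hT
  have e := (h.evacuation hA).evacuation hA.chainEvacuation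
  rw [hA.evacuation_evacuation] at e
  exact eq_of_encodes (mapsTo_evacuation (mapsTo_evacuation hT)) hT e h

theorem promotion_evacuation_promotion {T : ℕ → ℕ → ℕ} (hT : T ∈ SSYT k lam) :
    promotion k lam.cells (evacuation k lam.cells (promotion k lam.cells T)) =
      evacuation k lam.cells T := by
  obtain ⟨A, hA, h⟩ := exists_chain hT
  have e := ((h.promotion hA).evacuation hA.chainPromotion).promotion
    hA.chainPromotion.chainEvacuation
  rw [hA.chainPromotion_evacuation_promotion] at e
  exact eq_of_encodes (mapsTo_promotion (mapsTo_evacuation (mapsTo_promotion hT)))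
    (mapsTo_evacuation hT) e (h.evacuation hA)

/-- Write E for evacuation and P for promotion: P E P = E together with E² = 1 makes E P E an
inverse of P. -/
theorem bijOn_promotion : Set.BijOn (promotion k lam.cells) (SSYT k lam) (SSYT k lam) := by
  refine ⟨mapsTo_promotion, fun T hT U hU e => ?_, fun T hT => ?_⟩
  · rw [← evacuation_evacuation hT, ← evacuation_evacuation hU,
      ← promotion_evacuation_promotion hT, ← promotion_evacuation_promotion hU, e]
  · have hE := mapsTo_evacuation hT
    exact ⟨_, mapsTo_evacuation (mapsTo_promotion hE),
      by rw [promotion_evacuation_promotion hE, evacuation_evacuation hT]⟩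

variable {m n : ℕ}

theorem mem_rectangle {i j : ℕ} : (i, j) ∈ (rectangle m n).cells ↔ i < m ∧ j < n := by
  simp [rectangle]

theorem top_rectangle {T : ℕ → ℕ → ℕ} (hA : IsChain k A)
    (h : Encodes (rectangle m n).cells T A) : A k = rectangleRows m n := by
  have hsh : ∀ i j, (i < m ∧ j < n) ↔ (j : ℤ) < A k i := by
    intro i j
    rw [← mem_rectangle]
    exact ⟨fun hm => ((h _ i j).1 ⟨hm, le_rfl⟩).trans_le (hA.le_top _ i),
      fun hj => ((h k i j).2 hj).1⟩
  funext i
  obtain ⟨a, ha⟩ := Int.eq_ofNat_of_zero_le (hA.nonneg k i)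
  have hsh := hsh i
  rw [ha, rectangleRows]
  simp only [ha, Nat.cast_lt] at hsh ⊢
  split_ifs with hi
  · norm_cast
    exact eq_of_forall_lt_iff fun j => by simp [← hsh, hi]
  · have := hsh 0
    norm_cast
    omega

theorem iterate_promotion_rectangle {T : ℕ → ℕ → ℕ} (hT : T ∈ SSYT k (rectangle m n)) :
    (promotion k (rectangle m n).cells)^[k] T = T := by
  obtain ⟨A, hA, h⟩ := exists_chain hT
  have key : ∀ i, (promotion k (rectangle m n).cells)^[i] T ∈ SSYT k (rectangle m n) ∧
      Encodes (rectangle m n).cells ((promotion k (rectangle m n).cells)^[i] T)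
        ((chainPromotion k)^[i] A) := by
    intro i
    induction i with
    | zero => exact ⟨hT, h⟩
    | succ i ih =>
      rw [Function.iterate_succ_apply', Function.iterate_succ_apply']
      exact ⟨mapsTo_promotion ih.1, ih.2.promotion (hA.iterate i)⟩
  have e := (key k).2
  rw [hA.iterate_rectangle (top_rectangle hA h)] at e
  exact eq_of_encodes (key k).1 hT e h

theorem evacuation_rectangle {T : ℕ → ℕ → ℕ} (hT : T ∈ SSYT k (rectangle m n)) :
    evacuation k (rectangle m n).cells T = rotateComplement k m n T := by
  obtain ⟨A, hA, h⟩ := exists_chain hT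
  have htop := top_rectangle hA h
  refine (h.evacuation hA).ext ?_ (mem_SSYT_iff.1 (mapsTo_evacuation hT)).1 ?_
  · intro t i j
    rw [mem_rectangle, rotateComplement]
    by_cases hij : i < m ∧ j < n
    · simp only [hij, and_self, if_true, true_and]
      have hm : (m - 1 - i, n - 1 - j) ∈ (rectangle m n).cells := mem_rectangle.2 (by omega)
      rcases Nat.le_total t k with ht | ht
      · rw [hA.evacuation_rectangle htop ht hij.1]
        -- The complemented entry is at most `t` exactly if the original one exceeds `k - t`, that
        -- is, if its column `n - 1 - j` is not below `A (k - t) (m - 1 - i)`.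
        have a := h (k - t) (m - 1 - i) (n - 1 - j)
        simp only [hm, true_and] at a
        obtain ⟨T', rfl, hT'⟩ := hT
        have b := hT' _ _ hm
        omega
      · rw [hA.chainEvacuation.const t ht, chainEvacuation_of_le le_rfl, htop, rectangleRows,
          if_pos hij.1]
        obtain ⟨T', rfl, hT'⟩ := hT
        have b := hT' _ _ hm
        omega
    · refine iff_of_false (fun hc => hij hc.1) fun hc => hij ?_
      have a := hc.trans_le (hA.chainEvacuation.le_top t i)
      rw [chainEvacuation_of_le le_rfl, htop, rectangleRows] at a
      split_ifs at a <;> omega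
  · intro i j hm
    rw [rotateComplement, if_neg (mem_rectangle.not.1 hm)]

end SSYTPromotion

open SSYTPromotion in
theorem theorem2p6 (k : ℕ) (lam : YoungDiagram) :
    -- promotion and evacuation act on `SSYT_k(lam)`, and promotion is invertible there
    Set.BijOn (promotion k lam.cells) (SSYT k lam) (SSYT k lam) ∧
    Set.MapsTo (evacuation k lam.cells) (SSYT k lam) (SSYT k lam) ∧
    -- (a)
    (∀ T ∈ SSYT k lam, evacuation k lam.cells (evacuation k lam.cells T) = T) ∧
    -- (b)
    (∀ T ∈ SSYT k lam, evacuation k lam.cells (promotion k lam.cells T) =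
      Function.invFunOn (promotion k lam.cells) (SSYT k lam) (evacuation k lam.cells T)) ∧
    (∀ m n : ℕ, lam = rectangle m n →
      -- (c)
      (∀ T ∈ SSYT k lam, (promotion k lam.cells)^[k] T = T) ∧
      -- (d)
      (∀ T ∈ SSYT k lam, evacuation k lam.cells T = rotateComplement k m n T)) := by
  refine ⟨bijOn_promotion, mapsTo_evacuation, fun T hT => evacuation_evacuation hT, fun T hT => ?_,
    ?_⟩
  · rw [← promotion_evacuation_promotion hT]
    exact (bijOn_promotion.injOn.leftInvOn_invFunOn
      (mapsTo_evacuation (mapsTo_promotion hT))).symm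
  · rintro m n rfl
    exact ⟨fun T hT => iterate_promotion_rectangle hT, fun T hT => evacuation_rectangle hT⟩
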